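/- **Functional limit laws for $\widehat F$ and $\widehat Q^{*}$.** Let $\mathcal U=[0,1]$, let $\mathcal X\subset\mathbb R^d$ be compact, and let $\mathcal{UX}=\mathcal U\times\mathcal X$. Let $Q:\mathcal{UX}\to\mathbb R$, $(u,x)\mapsto Q(u|x)$, be continuous with a partial derivative $\partial_uQ(u|x)$ (one-sided at $u=0,1$) that exists and is continuous on $\mathcal{UX}$, and let the number of elements of $\{u\in\mathcal U:\partial_uQ(u|x)=0\}$ be bounded uniformly in $x\in\mathcal X$. For a bounded measurable $q$ on $\mathcal{UX}$ put $$F_q(y|x)=\int_0^1 1\{q(u|x)\le y\}\,du,\qquad q^{*}(u|x)=\inf\{y:F_q(y|x)\ge u\}\quad(0<u\le1),\qquad q^*(0|x)=\inf\{y:F_q(y|x)>0\},$$ and write $F=F_Q$, $\widehat F_n=F_{\widehat Q_n}$. Let $\widehat Q_n$ be random functions on $\mathcal{UX}$ whose realizations are bounded and measurable, let $a_n\to\infty$ be real constants, and suppose that $$a_n(\widehat Q_n-Q)\Rightarrow G\quad\text{in }\ell^\infty(\mathcal{UX}),$$ where $G$ has continuous paths. Here $\ell^\infty(T)$ is the space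 of bounded measurable functions on $T$ with the supremum norm, and $\Rightarrow$ is weak convergence in the sense of Hoffmann-Jørgensen (the limit is Borel measurable, and outer expectations of bounded continuous functionals converge). Call $y$ a regular value of $Q(\cdot|x)$ if the set $R(y|x)=\{u\in\mathcal U:Q(u|x)=y\}$ is nonempty and $\partial_uQ(u|x)\ne0$ for all $u\in R(y|x)$; let $\mathcal{YX}^{*}$ be the set of $(y,x)$ with $x\in\mathcal X$ and $y$ a regular value of $Q(\cdot|x)$. For $h:\mathcal{UX}\to\mathbb R$, for $(y,x)\in\mathcal{YX}^*$, and for $(u,x)\in\mathcal{UX}$ with $(Q^*(u|x),x)\in\mathcal{YX}^*$, set $$D_h(y|x)=-\sum_{v\in R(y|x)}\frac{h(v|x)}{|\partial_uQ(v|x)|},\qquad f(y|x)=\sum_{v\in R(y|x)}\frac1{|\partial_uQ(v|x)|},\qquad \widetilde D_h(u|x)=-\frac{D_h(Q^{*}(u|x)|x)}{f(Q^{*}(u|x)|x)}.$$ Then: 1. For every compact $K\subset\mathcal{YX}^{*}$ such that $R(y|x)\subset(0,1)$ for all $(y,x)\in K$, $$a_n(\widehat F_n-F)\Rightarrow D_G\quad\text{in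 }\ell^\infty(K).$$ 2. For every compact $K\subset\mathcal{YX}^{*}$ such that, for each $(y,x)\in K$, either $R(y|x)\subset(0,1)$ or $R(y|x)$ consists of a single point, with $\mathcal{UX}_K=\{(u,x)\in\mathcal{UX}:(Q^{*}(u|x),x)\in K\}$, $$a_n(\widehat Q_n^{*}-Q^{*})\Rightarrow\widetilde D_G\quad\text{in }\ell^\infty(\mathcal{UX}_K).$$ -/

import Mathlib

open Set Filter Topology MeasureTheory
open scoped ENNReal BoundedContinuousFunction

/-! ## Bounded measurable functions and weak convergence -/

/-- The space `ℓ^∞(T)` of bounded measurable functions `T → ℝ`, with the supremum norm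
(as a subspace of the space `lp (fun _ : T => ℝ) ∞` of all bounded functions). -/
def EllInf (T : Type*) [MeasurableSpace T] : Submodule ℝ (lp (fun _ : T => ℝ) ∞) where
  carrier := {f | Measurable (fun t : T => f t)}
  add_mem' := fun {f g} hf hg => by
    have h : Measurable (fun t : T => f t + g t) := Measurable.add hf hg
    exact h
  zero_mem' := by
    have h : Measurable (fun _ : T => (0 : ℝ)) := measurable_const
    exact h
  smul_mem' := fun c f hf => by
    have h : Measurable (fun t : T => c * f t) := Measurable.const_mul hf c
    exact h

/-- The outer expectation `E^* Z` of a (bounded, possibly non-measurable) real function `Z`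
on a probability space: the infimum of `E U` over all integrable measurable `U ≥ Z`. -/
noncomputable def outerExpectation {Ω : Type*} [MeasurableSpace Ω] (P : Measure Ω)
    (Z : Ω → ℝ) : ℝ :=
  sInf {c : ℝ | ∃ U : Ω → ℝ, Measurable U ∧ Integrable U P ∧ (∀ ω, Z ω ≤ U ω) ∧
    ∫ ω, U ω ∂P = c}

/-- Weak convergence `Z n ⇒ Z'` in `ℓ^∞(T)` (in the sense of Hoffmann-Jørgensen): all sample
paths of the processes `Z n`, `Z'` indexed by `T` are elements of `ℓ^∞(T)`, the limit is a Borel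
measurable random element of `ℓ^∞(T)`, and `E^* φ(Z n) → E φ(Z')` for every bounded continuous
`φ : ℓ^∞(T) → ℝ`. The maps `Z n` need not be Borel measurable and may live on
different probability spaces. -/
def ConvergesWeakly {T : Type*} [MeasurableSpace T]
    {Ω : ℕ → Type*} [∀ n, MeasurableSpace (Ω n)] (P : ∀ n, Measure (Ω n))
    (Z : ∀ n, Ω n → T → ℝ)
    {Ω' : Type*} [MeasurableSpace Ω'] (P' : Measure Ω') (Z' : Ω' → T → ℝ) : Prop :=
  ∃ (W : ∀ n, Ω n → EllInf T) (W' : Ω' → EllInf T),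
    (∀ n ω t, (W n ω : lp (fun _ : T => ℝ) ∞) t = Z n ω t) ∧
    (∀ ω t, (W' ω : lp (fun _ : T => ℝ) ∞) t = Z' ω t) ∧
    Measurable[_, borel (EllInf T)] W' ∧
    ∀ φ : EllInf T →ᵇ ℝ,
      Tendsto (fun n => outerExpectation (P n) (fun ω => φ (W n ω))) atTop
        (𝓝 (∫ ω, φ (W' ω) ∂P'))

/-! ## Rearrangement of a curve `u ↦ q u x`, `u ∈ [0,1]` -/

/-- `F(y|x) = ∫₀¹ 1{q(u|x) ≤ y} du`. -/
noncomputable def distFun {E : Type*} (q : ℝ → E → ℝ) (y : ℝ) (x : E) : ℝ :=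
  ∫ u in (0 : ℝ)..1, indicator {v : ℝ | q v x ≤ y} (fun _ => (1 : ℝ)) u

/-- The rearranged curve `q^*(u|x) = inf {y : F(y|x) ≥ u}`. For `u > 0` the condition
`0 < F(y|x)` is implied by `u ≤ F(y|x)`; for `u = 0` it gives `q^*(0|x)` the usual value
`inf {y : F(y|x) > 0}`, the lower endpoint of the support (and not `-∞`). -/
noncomputable def rearrangement {E : Type*} (q : ℝ → E → ℝ) (u : ℝ) (x : E) : ℝ :=
  sInf {y : ℝ | u ≤ distFun q y x ∧ 0 < distFun q y x}

/-! ## Regular values -/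

/-- `∂_u Q(u|x)` on `[0,1]` (one-sided at the endpoints). -/
noncomputable def partialU {E : Type*} (Q : ℝ → E → ℝ) (u : ℝ) (x : E) : ℝ :=
  derivWithin (fun v => Q v x) (Icc 0 1) u

/-- The roots `u ∈ [0,1]` of `Q(u|x) = y`. -/
def rootSet {E : Type*} (Q : ℝ → E → ℝ) (y : ℝ) (x : E) : Set ℝ :=
  {u | u ∈ Icc (0 : ℝ) 1 ∧ Q u x = y}

/-- The regular values of `u ↦ Q(u|x)` on `[0,1]`: values that are attained, and attained
only at points where the derivative does not vanish. -/
def regularValues {E : Type*} (Q : ℝ → E → ℝ) (x : E) : Set ℝ :=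
  {y | (rootSet Q y x).Nonempty ∧ ∀ u ∈ rootSet Q y x, partialU Q u x ≠ 0}

/-- `UX = [0,1] × X`. -/
def domUX {E : Type*} (X : Set E) : Set (ℝ × E) := Icc (0 : ℝ) 1 ×ˢ X

/-- `YX^*`, the pairs `(y, x)` with `x ∈ X` and `y` a regular value of `u ↦ Q(u|x)`. -/
def regYX {E : Type*} (Q : ℝ → E → ℝ) (X : Set E) : Set (ℝ × E) :=
  {p | p.2 ∈ X ∧ p.1 ∈ regularValues Q p.2}

/-- `UX_K`, the pairs `(u, x) ∈ [0,1] × X` with `(Q^*(u|x), x) ∈ K`. -/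
def domUXK {E : Type*} (Q : ℝ → E → ℝ) (X : Set E) (K : Set (ℝ × E)) : Set (ℝ × E) :=
  {p | p ∈ domUX X ∧ (rearrangement Q p.1 p.2, p.2) ∈ K}

/-! ## The derivatives -/

/-- `D_h(y|x) = - ∑_k h(u_k(y|x)|x) / |∂_u Q(u_k(y|x)|x)|`, the sum over the roots
`u_k(y|x)` of `Q(u|x) = y`. -/
noncomputable def derivF {E : Type*} (Q h : ℝ → E → ℝ) (y : ℝ) (x : E) : ℝ :=
  - ∑ᶠ u ∈ rootSet Q y x, h u x / |partialU Q u x|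

/-- `f(y|x) = ∑_k 1 / |∂_u Q(u_k(y|x)|x)|` at regular values `y`, and `0` elsewhere. -/
noncomputable def densF {E : Type*} (Q : ℝ → E → ℝ) (y : ℝ) (x : E) : ℝ :=
  indicator (regularValues Q x) (fun z => ∑ᶠ u ∈ rootSet Q z x, 1 / |partialU Q u x|) y

/-- `D̃_h(u|x) = - D_h(Q^*(u|x)|x) / f(Q^*(u|x)|x)`. -/
noncomputable def derivQ {E : Type*} (Q h : ℝ → E → ℝ) (u : ℝ) (x : E) : ℝ :=
  - (1 / densF Q (rearrangement Q u x) x) * derivF Q h (rearrangement Q u x) x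

/-! ## Assumptions on the curve -/

/-- The assumptions on the population curve `Q` on `[0,1] × X`: `Q` and `∂_u Q` exist and are
continuous on `[0,1] × X`, and the number of critical points of `u ↦ Q(u|x)` is bounded uniformly
in `x ∈ X`. (No derivative in `x` is required.) -/
structure IsAdmissibleCurve {E : Type*} [TopologicalSpace E] (X : Set E) (Q : ℝ → E → ℝ) :
    Prop where
  continuousOn : ContinuousOn (fun p : ℝ × E => Q p.1 p.2) (domUX X)
  differentiableOn : ∀ x ∈ X, DifferentiableOn ℝ (fun u => Q u x) (Icc 0 1)
  continuousOn_partialU : ContinuousOn (fun p : ℝ × E => partialU Q p.1 p.2) (domUX X)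
  critical_bounded : ∃ N : ℕ, ∀ x ∈ X, {u | u ∈ Icc (0 : ℝ) 1 ∧ partialU Q u x = 0}.encard ≤ N

/-!
Both limit laws are instances of a functional delta method: `q ↦ F_q` and `q ↦ q^*` are
differentiable at `Q`, uniformly over the index set, along perturbations `q` with
`|q - Q - t h| ≤ δ t`, where `h` is continuous (`HasUniformDerivative`).

*Delta method* (`ConvergesWeakly.of_continuous_convergence`). If `V_n` is close to `V'` whenever
`Z_n` is close to `Z'`, uniformly over the underlying sample points, then `Z_n ⇒ Z'` implies
`V_n ⇒ V'`. For a bounded continuous `g`, the Lipschitz envelope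
`w ↦ sup_{n ≥ m, ω} (g (V_n ω) - m * dist w (W_n ω))` is a continuous function of the original
process that dominates `g (V_n)` for all `n ≥ m`, and its limit superior at `W'` as `m → ∞` is at
most `g (V')`. Monotonicity of outer expectations and dominated convergence then bound
`limsup E^* g (V_n)`; applied to `-g`, the argument bounds the limit inferior. Neither separability
nor an almost sure representation is needed.

*Distribution functions* (`eventually_abs_distFun_sub`). Near a regular value `y₀` of `Q(·|x₀)`,
attained in `(0,1)` only, a small perturbation changes the set `{u : Q(u|x) ≤ y}` only in small
intervals around the finitely many roots of `Q(u|x₀) = y₀`. In such an interval `Q(·|x)` is almost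
affine with slope `d = ∂_u Q(r|x₀)`, and the measure of the set changes by about
`-t h(r|x₀) / |d|` (`abs_measureReal_sublevel_sub_le`).

*Rearrangements* (`eventually_abs_rearrangement_sub`). An expansion `q^* = Q^* + t (c + o(1))`
follows from the one-sided comparisons `F_Q(y) ≤ F_q(y + t (c + ε))` and
`F_q(y + t (c - ε)) ≤ F_Q(y)`, for `y` near `Q^*(u|x)`. At a regular value attained in `(0,1)` only,
these follow from the expansion of `F` with `h - (c ± ε)` in place of `h`. At a value with a single
root `r` they hold with `c = h(r|x₀)` because `q - Q` is close to `t c` near `r`, and elsewhere `q`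
and `Q` lie on the same side of `y`; this covers the endpoints `r = 0, 1` too.

*Uniformity* (`hasUniformDerivative_of_eventually`). The local expansions have the derivative at the
centre `p₀` of the neighbourhood in place of the derivative at the point itself. Comparing the
expansions centred at `p₀` and at the point shows that the derivative is continuous, so that
compactness of `K` gives uniformity, and the roots need not be followed as functions of `(y, x)`.
In the same way, measurability, boundedness and continuous dependence on `h` of the derivative come
from the uniform expansion.
-/

/-! ### Outer expectations and weak convergence -/

theorem outerExpectation_mono {Ω : Type*} [MeasurableSpace Ω] {P : Measure Ω}
    [IsProbabilityMeasure P] {Z Z' : Ω → ℝ} {M : ℝ} (hZ : ∀ ω, -M ≤ Z ω) (hZ' : ∀ ω, Z' ω ≤ M)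
    (h : ∀ ω, Z ω ≤ Z' ω) : outerExpectation P Z ≤ outerExpectation P Z' := by
  refine csInf_le_csInf ⟨-M, ?_⟩ ?_ ?_
  · rintro c ⟨U, -, hUi, hU, rfl⟩
    have := integral_mono (integrable_const (-M)) hUi (fun ω => (hZ ω).trans (hU ω))
    simpa using this
  · exact ⟨_, fun _ => M, measurable_const, integrable_const M, hZ', rfl⟩
  · rintro c ⟨U, hUm, hUi, hU, rfl⟩
    exact ⟨U, hUm, hUi, fun ω => (h ω).trans (hU ω), rfl⟩

/-- If `v n ω` is asymptotically at most `v'` wherever `W n ω` approaches `W'`, then up to `ε` in mean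
the variables `v n`, for `n` large, are dominated by one bounded continuous function of `W n`. The
function is a Lipschitz envelope, truncated from below at `-M`. -/
theorem exists_boundedContinuous_majorant {𝔻 : Type*} [PseudoMetricSpace 𝔻] {Ω : ℕ → Type*}
    [∀ n, Nonempty (Ω n)] (W : ∀ n, Ω n → 𝔻) {Ω' : Type*} [MeasurableSpace Ω'] (P' : Measure Ω')
    [IsProbabilityMeasure P'] {W' : Ω' → 𝔻} (hW' : Measurable[_, borel 𝔻] W')
    {v : ∀ n, Ω n → ℝ} {v' : Ω' → ℝ} (hv'm : Measurable v') {M : ℝ}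
    (hv : ∀ n ω, |v n ω| ≤ M) (hv' : ∀ ω, |v' ω| ≤ M)
    (hlim : ∀ ω', ∀ ε > 0, ∃ δ > 0, ∃ N, ∀ n ≥ N, ∀ ω, dist (W n ω) (W' ω') < δ →
      v n ω ≤ v' ω' + ε)
    {ε : ℝ} (hε : 0 < ε) :
    ∃ (φ : 𝔻 →ᵇ ℝ) (m : ℕ), (∀ w, |φ w| ≤ M) ∧ (∀ n ≥ m, ∀ ω, v n ω ≤ φ (W n ω)) ∧
      ∫ ω, φ (W' ω) ∂P' ≤ ∫ ω, v' ω ∂P' + ε := by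
  have hne : ∀ m : ℕ, Nonempty (Σ n : Ici m, Ω n) :=
    fun m => ⟨⟨⟨m, self_mem_Ici⟩, Classical.arbitrary _⟩⟩
  have hM0 : 0 ≤ M := (abs_nonneg _).trans (hv 0 (Classical.arbitrary _))
  set s : ℕ → 𝔻 → ℝ := fun m w =>
    ⨆ i : Σ n : Ici m, Ω n, (v i.1.1 i.2 - m * dist w (W i.1.1 i.2)) with hs
  have hle : ∀ m w (i : Σ n : Ici m, Ω n), v i.1.1 i.2 - m * dist w (W i.1.1 i.2) ≤ M := by
    intro m w i
    have h1 := (abs_le.1 (hv i.1.1 i.2)).2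
    have h2 : 0 ≤ (m : ℝ) * dist w (W i.1.1 i.2) := by positivity
    linarith
  have hbdd : ∀ m w, BddAbove (range fun i : Σ n : Ici m, Ω n =>
      v i.1.1 i.2 - m * dist w (W i.1.1 i.2)) := by
    rintro m w
    exact ⟨M, by rintro _ ⟨i, rfl⟩; exact hle m w i⟩
  have hlip : ∀ m : ℕ, LipschitzWith m (s m) := by
    intro m
    refine LipschitzWith.of_le_add_mul _ fun w w' => ciSup_le fun i => ?_
    have h1 := le_ciSup (hbdd m w') i
    have h2 : (m : ℝ) * dist w' (W i.1.1 i.2) ≤ m * (dist w w' + dist w (W i.1.1 i.2)) := by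
      gcongr
      rw [dist_comm w w']
      exact dist_triangle _ _ _
    simp only [NNReal.coe_natCast]
    have h3 : s m w' = ⨆ i : Σ n : Ici m, Ω n, (v i.1.1 i.2 - m * dist w' (W i.1.1 i.2)) := rfl
    linarith
  have hcont : ∀ m, Continuous fun w => max (-M) (s m w) :=
    fun m => continuous_const.max (hlip m).continuous
  have habs : ∀ m w, |max (-M) (s m w)| ≤ M := fun m w =>
    abs_le.2 ⟨le_max_left _ _, max_le (by linarith) (ciSup_le (hle m w))⟩
  have hmeas : ∀ m, Measurable fun ω => max (-M) (s m (W' ω)) := by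
    intro m
    let _ : MeasurableSpace 𝔻 := borel 𝔻
    have : BorelSpace 𝔻 := ⟨rfl⟩
    exact (hcont m).measurable.comp hW'
  -- The envelopes at `W' ω` need not lie above `v' ω`, hence the maximum.
  have hpt : ∀ ω, Tendsto (fun m : ℕ => max (max (-M) (s m (W' ω))) (v' ω)) atTop
      (𝓝 (v' ω)) := by
    intro ω
    refine tendsto_order.2 ⟨fun a ha => Eventually.of_forall fun m => lt_max_of_lt_right ha,
      fun a ha => ?_⟩
    obtain ⟨δ, hδ, N, hN⟩ := hlim ω ((a - v' ω) / 2) (by linarith)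
    have hbig : ∀ᶠ m : ℕ in atTop, 2 * M / δ ≤ m :=
      tendsto_natCast_atTop_atTop.eventually_ge_atTop _
    filter_upwards [hbig, eventually_ge_atTop N] with m hm hmN
    have hvM := abs_le.1 (hv' ω)
    have : s m (W' ω) ≤ v' ω + (a - v' ω) / 2 := by
      refine ciSup_le fun i => ?_
      by_cases hd : dist (W i.1.1 i.2) (W' ω) < δ
      · have h1 := hN i.1 (hmN.trans i.1.2) i.2 hd
        have h2 : 0 ≤ (m : ℝ) * dist (W' ω) (W i.1.1 i.2) := by positivity
        linarith
      · rw [not_lt, dist_comm] at hd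
        have h1 : 2 * M ≤ m * δ := (div_le_iff₀ hδ).1 hm
        have h2 : (m : ℝ) * δ ≤ m * dist (W' ω) (W i.1.1 i.2) := by gcongr
        have h3 := (abs_le.1 (hv i.1.1 i.2)).2
        linarith
    exact max_lt (max_lt (by linarith) (by linarith)) ha
  have hint : Tendsto (fun m : ℕ => ∫ ω, max (max (-M) (s m (W' ω))) (v' ω) ∂P') atTop
      (𝓝 (∫ ω, v' ω ∂P')) := by
    refine tendsto_integral_of_dominated_convergence (fun _ => M)
      (fun m => ((hmeas m).max hv'm).aestronglyMeasurable) (integrable_const M)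
      (fun m => Eventually.of_forall fun ω => ?_) (Eventually.of_forall hpt)
    exact abs_le.2 ⟨le_max_of_le_left (le_max_left _ _),
      max_le (abs_le.1 (habs m _)).2 (abs_le.1 (hv' ω)).2⟩
  obtain ⟨m, hm⟩ := (hint.eventually_lt_const (lt_add_of_pos_right _ hε)).exists
  refine ⟨BoundedContinuousFunction.ofNormedAddCommGroup _ (hcont m) M (habs m), m, habs m,
    fun n hn ω => ?_, le_trans ?_ hm.le⟩
  · refine le_max_of_le_right ?_
    have := le_ciSup (hbdd m (W n ω)) ⟨⟨n, hn⟩, ω⟩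
    simpa using this
  · refine integral_mono ?_ ?_ fun ω => le_max_left _ _
    · exact Integrable.of_bound (hmeas m).aestronglyMeasurable M
        (Eventually.of_forall fun ω => habs m _)
    · exact Integrable.of_bound ((hmeas m).max hv'm).aestronglyMeasurable M
        (Eventually.of_forall fun ω => abs_le.2 ⟨le_max_of_le_left (le_max_left _ _),
          max_le (abs_le.1 (habs m _)).2 (abs_le.1 (hv' ω)).2⟩)

theorem exists_ellInf {T : Type*} [MeasurableSpace T] {f : T → ℝ} (hf : Measurable f)
    (hb : ∃ C, ∀ t, |f t| ≤ C) : ∃ w : EllInf T, ∀ t, (w : lp (fun _ : T => ℝ) ∞) t = f t := by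
  obtain ⟨C, hC⟩ := hb
  exact ⟨⟨⟨f, memℓp_infty ⟨C, by rintro _ ⟨t, rfl⟩; exact hC t⟩⟩, hf⟩, fun t => rfl⟩

theorem EllInf.dist_le {T : Type*} [MeasurableSpace T] {w w' : EllInf T} {C : ℝ} (hC : 0 ≤ C)
    (h : ∀ t, |(w : lp (fun _ : T => ℝ) ∞) t - (w' : lp (fun _ : T => ℝ) ∞) t| ≤ C) :
    dist w w' ≤ C := by
  rw [dist_eq_norm]
  exact lp.norm_le_of_forall_le hC h

theorem EllInf.abs_sub_le_dist {T : Type*} [MeasurableSpace T] (w w' : EllInf T) (t : T) :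
    |(w : lp (fun _ : T => ℝ) ∞) t - (w' : lp (fun _ : T => ℝ) ∞) t| ≤ dist w w' := by
  rw [dist_eq_norm]
  exact lp.norm_apply_le_norm ENNReal.top_ne_zero
    ((w - w' : EllInf T) : lp (fun _ : T => ℝ) ∞) t

/-- Extended continuous mapping theorem for Hoffmann-Jørgensen convergence. The hypothesis `hlim` asks
that `V n` be close to `V'` when `Z n` is close to `Z'`; `hcont` says that `V'` is a continuous
function of `Z'` and serves for the Borel measurability of the limit only. -/
theorem ConvergesWeakly.of_continuous_convergence {S T : Type*} [MeasurableSpace S]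
    [MeasurableSpace T] {Ω : ℕ → Type*} [∀ n, MeasurableSpace (Ω n)] {P : ∀ n, Measure (Ω n)}
    [∀ n, IsProbabilityMeasure (P n)] {Ω' : Type*} [MeasurableSpace Ω'] {P' : Measure Ω'}
    [IsProbabilityMeasure P'] {Z : ∀ n, Ω n → S → ℝ} {Z' : Ω' → S → ℝ}
    (hZ : ConvergesWeakly P Z P' Z') {V : ∀ n, Ω n → T → ℝ} {V' : Ω' → T → ℝ}
    (hVm : ∀ n ω, Measurable (V n ω)) (hVb : ∀ n ω, ∃ C, ∀ t, |V n ω t| ≤ C)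
    (hVm' : ∀ ω, Measurable (V' ω)) (hVb' : ∀ ω, ∃ C, ∀ t, |V' ω t| ≤ C)
    (hcont : ∀ ω, ∀ ε > 0, ∃ δ > 0, ∀ ω', (∀ s, |Z' ω' s - Z' ω s| ≤ δ) →
      ∀ t, |V' ω' t - V' ω t| ≤ ε)
    (hlim : ∀ ω', ∀ ε > 0, ∃ δ > 0, ∃ N, ∀ n ≥ N, ∀ ω, (∀ s, |Z n ω s - Z' ω' s| ≤ δ) →
      ∀ t, |V n ω t - V' ω' t| ≤ ε) :
    ConvergesWeakly P V P' V' := by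
  obtain ⟨W, W', hW, hW', hWm, hφ⟩ := hZ
  choose Y hY using fun n ω => exists_ellInf (hVm n ω) (hVb n ω)
  choose Y' hY' using fun ω => exists_ellInf (hVm' ω) (hVb' ω)
  -- The preimage of an open set under `Y'` is the preimage under `W'` of a union of balls.
  have hYm : Measurable[_, borel (EllInf T)] Y' := by
    refine measurable_generateFrom fun O (hO : IsOpen O) => ?_
    have : ∀ ω ∈ Y' ⁻¹' O, ∃ δ > 0, W' ⁻¹' (Metric.ball (W' ω) δ) ⊆ Y' ⁻¹' O := by
      intro ω hω
      obtain ⟨ε, hε, hball⟩ := Metric.isOpen_iff.1 hO _ hω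
      obtain ⟨δ, hδ, h⟩ := hcont ω (ε / 2) (by linarith)
      refine ⟨δ, hδ, fun ω' hω' => hball ?_⟩
      rw [Metric.mem_ball]
      refine lt_of_le_of_lt (EllInf.dist_le (by linarith : 0 ≤ ε / 2) fun t => ?_) (by linarith)
      rw [hY', hY']
      refine h ω' (fun s => ?_) t
      rw [← hW', ← hW']
      exact (EllInf.abs_sub_le_dist _ _ s).trans (Metric.mem_ball.1 hω').le
    choose! δ hδ hsub using this
    have heq : Y' ⁻¹' O = W' ⁻¹' (⋃ ω ∈ Y' ⁻¹' O, Metric.ball (W' ω) (δ ω)) := by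
      refine Subset.antisymm (fun ω hω => ?_) ?_
      · exact mem_iUnion₂.2 ⟨ω, hω, Metric.mem_ball_self (hδ ω hω)⟩
      · rw [preimage_iUnion₂]
        exact iUnion₂_subset hsub
    rw [heq]
    have hopen : IsOpen (⋃ ω ∈ Y' ⁻¹' O, Metric.ball (W' ω) (δ ω)) :=
      isOpen_biUnion fun _ _ => Metric.isOpen_ball
    exact hWm (MeasurableSpace.measurableSet_generateFrom hopen)
  refine ⟨Y, Y', hY, hY', hYm, fun g => ?_⟩
  have : ∀ n, Nonempty (Ω n) := fun n => nonempty_of_isProbabilityMeasure (P n)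
  have hg : ∀ y, |g y| ≤ ‖g‖ := g.norm_coe_le_norm
  have hgm : Measurable fun ω => g (Y' ω) := by
    let _ : MeasurableSpace (EllInf T) := borel _
    have : BorelSpace (EllInf T) := ⟨rfl⟩
    exact g.continuous.measurable.comp hYm
  have hclose : ∀ ω', ∀ ε > 0, ∃ δ > 0, ∃ N, ∀ n ≥ N, ∀ ω, dist (W n ω) (W' ω') < δ →
      |g (Y n ω) - g (Y' ω')| < ε := by
    intro ω' ε hε
    obtain ⟨η, hη, hgη⟩ := Metric.continuous_iff.1 g.continuous (Y' ω') ε hε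
    obtain ⟨δ, hδ, N, h⟩ := hlim ω' (η / 2) (by linarith)
    refine ⟨δ, hδ, N, fun n hn ω hd => hgη _ ?_⟩
    refine lt_of_le_of_lt (EllInf.dist_le (by linarith : 0 ≤ η / 2) fun t => ?_) (by linarith)
    rw [hY, hY']
    refine h n hn ω (fun s => ?_) t
    rw [← hW, ← hW']
    exact (EllInf.abs_sub_le_dist _ _ s).trans hd.le
  refine tendsto_order.2 ⟨fun a ha => ?_, fun a ha => ?_⟩
  · obtain ⟨φ, m, hφM, hφv, hφi⟩ := exists_boundedContinuous_majorant W P' hWm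
      (v := fun n ω => -g (Y n ω)) (v' := fun ω => -g (Y' ω)) hgm.neg (M := ‖g‖)
      (fun n ω => by rw [abs_neg]; exact hg _) (fun ω => by rw [abs_neg]; exact hg _)
      (fun ω' ε hε => by
        obtain ⟨δ, hδ, N, h⟩ := hclose ω' ε hε
        refine ⟨δ, hδ, N, fun n hn ω hd => ?_⟩
        have := abs_lt.1 (h n hn ω hd)
        linarith)
      (ε := (∫ ω, g (Y' ω) ∂P' - a) / 2) (by linarith)
    have hlt : a < ∫ ω, (-φ) (W' ω) ∂P' := by
      simp only [BoundedContinuousFunction.coe_neg, Pi.neg_apply, integral_neg] at hφi ⊢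
      linarith
    filter_upwards [(hφ (-φ)).eventually_const_lt hlt, eventually_ge_atTop m] with n hn hnm
    refine hn.trans_le (outerExpectation_mono (M := ‖g‖) (fun ω => ?_) (fun ω => ?_) fun ω => ?_)
    · have := (abs_le.1 (hφM (W n ω))).2
      simpa using this
    · exact (abs_le.1 (hg _)).2
    · have := hφv n hnm ω
      simp only [BoundedContinuousFunction.coe_neg, Pi.neg_apply]
      linarith
  · obtain ⟨φ, m, hφM, hφv, hφi⟩ := exists_boundedContinuous_majorant W P' hWm
      (v := fun n ω => g (Y n ω)) (v' := fun ω => g (Y' ω)) hgm (M := ‖g‖)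
      (fun n ω => hg _) (fun ω => hg _)
      (fun ω' ε hε => by
        obtain ⟨δ, hδ, N, h⟩ := hclose ω' ε hε
        refine ⟨δ, hδ, N, fun n hn ω hd => ?_⟩
        have := abs_lt.1 (h n hn ω hd)
        linarith)
      (ε := (a - ∫ ω, g (Y' ω) ∂P') / 2) (by linarith)
    have hlt : ∫ ω, φ (W' ω) ∂P' < a := by linarith
    filter_upwards [(hφ φ).eventually_lt_const hlt, eventually_ge_atTop m] with n hn hnm
    exact lt_of_le_of_lt (outerExpectation_mono (M := ‖g‖) (fun ω => (abs_le.1 (hg _)).1)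
      (fun ω => (abs_le.1 (hφM _)).2) (hφv n hnm)) hn

/-! ### Sublevel sets of almost affine functions -/

theorem measurableSet_sublevel {f : ℝ → ℝ} (hf : Measurable fun v : Icc (0 : ℝ) 1 => f v) (y : ℝ) :
    MeasurableSet (Icc (0 : ℝ) 1 ∩ {v | f v ≤ y}) := by
  have h : MeasurableSet {v : Icc (0 : ℝ) 1 | f v ≤ y} := measurableSet_le hf measurable_const
  convert measurableSet_Icc.subtype_image h using 1
  ext v
  simp [and_comm]

theorem distFun_eq_measureReal {E : Type*} {q : ℝ → E → ℝ} {x : E}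
    (hq : Measurable fun v : Icc (0 : ℝ) 1 => q v x) (y : ℝ) :
    distFun q y x = volume.real (Icc (0 : ℝ) 1 ∩ {v | q v x ≤ y}) := by
  have hm := measurableSet_sublevel (f := fun v => q v x) hq y
  rw [distFun, intervalIntegral.integral_of_le zero_le_one, ← integral_Icc_eq_integral_Ioc,
    ← integral_indicator_one hm, ← integral_indicator measurableSet_Icc, indicator_indicator]
  rfl

/-- Two sets that agree off disjoint pieces `I r` differ in measure by the sum of the differences
over the pieces. -/
theorem measureReal_sub_eq_sum {α ι : Type*} [MeasurableSpace α] {μ : Measure α}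
    {R : Finset ι} {I : ι → Set α} {A B : Set α} (hI : ∀ r, MeasurableSet (I r))
    (hdisj : (R : Set ι).PairwiseDisjoint I) (hA : μ A ≠ ∞) (hB : μ B ≠ ∞)
    (hAB : A \ ⋃ r ∈ R, I r = B \ ⋃ r ∈ R, I r) (hAm : MeasurableSet A) (hBm : MeasurableSet B) :
    μ.real A - μ.real B = ∑ r ∈ R, (μ.real (I r ∩ A) - μ.real (I r ∩ B)) := by
  have key : ∀ C : Set α, μ C ≠ ∞ → MeasurableSet C →
      μ.real C = ∑ r ∈ R, μ.real (I r ∩ C) + μ.real (C \ ⋃ r ∈ R, I r) := by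
    intro C hC hCm
    rw [← measureReal_inter_add_sdiff (s := C) (R.measurableSet_biUnion fun r _ => hI r) hC,
      inter_comm, iUnion₂_inter, measureReal_biUnion_finset]
    · exact hdisj.mono fun r => inter_subset_left
    · exact fun r _ => (hI r).inter hCm
  rw [key A hA hAm, key B hB hBm, hAB, Finset.sum_sub_distrib]
  ring

theorem exists_sublevel_eq_Icc {a b d ρ s : ℝ} {φ : ℝ → ℝ} (hab : a ≤ b)
    (hρd : ρ < d) (hc : ContinuousOn φ (Icc a b))
    (hφ : ∀ u ∈ Icc a b, ∀ v ∈ Icc a b, |φ v - φ u - d * (v - u)| ≤ ρ * |v - u|)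
    (hs : φ a ≤ s) (hs' : s ≤ φ b) :
    ∃ v ∈ Icc a b, φ v = s ∧ Icc a b ∩ {u | φ u ≤ s} = Icc a v := by
  obtain ⟨v, hv, hvs⟩ := intermediate_value_Icc hab hc ⟨hs, hs'⟩
  have hmono : StrictMonoOn φ (Icc a b) := by
    intro u hu w hw huw
    have h1 := (abs_le.1 (hφ u hu w hw)).1
    rw [abs_of_pos (sub_pos.2 huw)] at h1
    nlinarith [mul_pos (sub_pos.2 hρd) (sub_pos.2 huw)]
  refine ⟨v, hv, hvs, ?_⟩
  ext u
  constructor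
  · rintro ⟨hu, hle⟩
    exact ⟨hu.1, (hmono.le_iff_le hu hv).1 (hvs ▸ hle)⟩
  · rintro ⟨h1, h2⟩
    have hu : u ∈ Icc a b := ⟨h1, h2.trans hv.2⟩
    exact ⟨hu, hvs ▸ (hmono.le_iff_le hu hv).2 h2⟩

/-- Change of the measure of `{φ ≤ 0}` under a perturbation `ψ ≈ φ + t c`, for `φ` almost affine with
slope `d > 0`: up to errors of order `t ρ`, the zero of `φ` moves by `-t c / d`. The set
`{ψ ≤ 0}` lies between the sublevel sets of `φ` at the levels `-t c - t ρ` and `-t c + t ρ`. -/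
theorem abs_measureReal_sublevel_sub_le_of_pos {a b d ρ t c : ℝ} {φ ψ : ℝ → ℝ} (hab : a ≤ b)
    (hd : 0 < d) (hρ : 0 < ρ) (hρd : 2 * ρ ≤ d) (ht : 0 < t) (hc : ContinuousOn φ (Icc a b))
    (hφ : ∀ u ∈ Icc a b, ∀ v ∈ Icc a b, |φ v - φ u - d * (v - u)| ≤ ρ * |v - u|)
    (ha : φ a ≤ -(t * (|c| + ρ))) (hb : t * (|c| + ρ) ≤ φ b)
    (hψ : ∀ u ∈ Icc a b, |ψ u - φ u - t * c| ≤ t * ρ) :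
    |volume.real (Icc a b ∩ {u | ψ u ≤ 0}) - volume.real (Icc a b ∩ {u | φ u ≤ 0}) + t * (c / d)|
      ≤ t * (ρ / d + 2 * ρ * (|c| + ρ) / d ^ 2) := by
  -- `v₀`, `v₁`, `v₂` are the points where `φ` takes the values `0` and `-t c ± t ρ`.
  have hlev : ∀ s, |s| ≤ t * (|c| + ρ) → ∃ v ∈ Icc a b, φ v = s ∧
      Icc a b ∩ {u | φ u ≤ s} = Icc a v := fun s hs =>
    exists_sublevel_eq_Icc hab (by linarith) hc hφ (ha.trans (abs_le.1 hs).1)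
      ((abs_le.1 hs).2.trans hb)
  have htc : |t * c| = t * |c| := by rw [abs_mul, abs_of_pos ht]
  have hcb := abs_le.1 htc.le
  have hB : 0 ≤ t * (|c| + ρ) := by positivity
  have htρ : 0 < t * ρ := by positivity
  obtain ⟨v₀, hv₀, hφv₀, he₀⟩ := hlev 0 (by simpa using hB)
  have hs₁ : |-(t * c) + t * ρ| ≤ t * (|c| + ρ) := abs_le.2 ⟨by linarith, by linarith⟩
  have hs₂ : |-(t * c) - t * ρ| ≤ t * (|c| + ρ) := abs_le.2 ⟨by linarith, by linarith⟩
  obtain ⟨v₁, hv₁, hφv₁, he₁⟩ := hlev _ hs₁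
  obtain ⟨v₂, hv₂, hφv₂, he₂⟩ := hlev _ hs₂
  have hdist : ∀ v ∈ Icc a b, |φ v| ≤ t * (|c| + ρ) →
      |v - v₀ - φ v / d| ≤ 2 * ρ * (t * (|c| + ρ)) / d ^ 2 := by
    intro v hv hvB
    have h1 := hφ v₀ hv₀ v hv
    rw [hφv₀, sub_zero] at h1
    have h2 : d * |v - v₀| ≤ 2 * |φ v| := by
      have : |d * (v - v₀)| ≤ |φ v| + |φ v - d * (v - v₀)| := by
        have := abs_sub (φ v) (φ v - d * (v - v₀))
        simpa using this
      rw [abs_mul, abs_of_pos hd] at this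
      nlinarith [abs_nonneg (v - v₀)]
    have h3 : v - v₀ - φ v / d = -((φ v - d * (v - v₀)) / d) := by field_simp; ring
    rw [h3, abs_neg, abs_div, abs_of_pos hd, div_le_div_iff₀ hd (by positivity)]
    calc |φ v - d * (v - v₀)| * d ^ 2 ≤ (ρ * |v - v₀|) * d ^ 2 := by gcongr
      _ = ρ * (d * |v - v₀|) * d := by ring
      _ ≤ ρ * (2 * (t * (|c| + ρ))) * d :=
        mul_le_mul_of_nonneg_right (mul_le_mul_of_nonneg_left (by linarith) hρ.le) hd.le
      _ = _ := by ring
  have hvol : ∀ v ∈ Icc a b, volume.real (Icc a v) = v - a := fun v hv => by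
    rw [Real.volume_real_Icc_of_le hv.1]
  have hup : volume.real (Icc a b ∩ {u | ψ u ≤ 0}) ≤ v₁ - a := by
    rw [← hvol v₁ hv₁, ← he₁]
    refine measureReal_mono ?_ (measure_ne_top_of_subset inter_subset_left (by simp))
    rintro u ⟨hu, hu0 : ψ u ≤ 0⟩
    refine ⟨hu, ?_⟩
    have := abs_le.1 (hψ u hu)
    simp only [mem_ofPred_eq]
    linarith
  have hlo : v₂ - a ≤ volume.real (Icc a b ∩ {u | ψ u ≤ 0}) := by
    rw [← hvol v₂ hv₂, ← he₂]
    refine measureReal_mono ?_ (measure_ne_top_of_subset inter_subset_left (by simp))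
    rintro u ⟨hu, hu0⟩
    refine ⟨hu, ?_⟩
    have := abs_le.1 (hψ u hu)
    simp only [mem_ofPred_eq] at hu0 ⊢
    linarith
  rw [he₀, hvol v₀ hv₀]
  have h1 := abs_le.1 (hdist v₁ hv₁ (hφv₁ ▸ hs₁))
  have h2 := abs_le.1 (hdist v₂ hv₂ (hφv₂ ▸ hs₂))
  rw [hφv₁] at h1
  rw [hφv₂] at h2
  have e1 : (-(t * c) + t * ρ) / d = -(t * (c / d)) + t * (ρ / d) := by ring
  have e2 : (-(t * c) - t * ρ) / d = -(t * (c / d)) - t * (ρ / d) := by ring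
  have e3 : t * (ρ / d + 2 * ρ * (|c| + ρ) / d ^ 2)
      = t * (ρ / d) + 2 * ρ * (t * (|c| + ρ)) / d ^ 2 := by ring
  rw [e1] at h1
  rw [e2] at h2
  rw [e3]
  exact abs_le.2 ⟨by linarith, by linarith⟩

/-- Version of `abs_measureReal_sublevel_sub_le_of_pos` for slopes of either sign; the case `d < 0`
reduces to `d > 0` by the reflection `u ↦ -u`. -/
theorem abs_measureReal_sublevel_sub_le {a b d ρ t c : ℝ} {φ ψ : ℝ → ℝ} (hab : a ≤ b)
    (hd : d ≠ 0) (hρ : 0 < ρ) (hρd : 2 * ρ ≤ |d|) (ht : 0 < t) (hc : ContinuousOn φ (Icc a b))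
    (hφ : ∀ u ∈ Icc a b, ∀ v ∈ Icc a b, |φ v - φ u - d * (v - u)| ≤ ρ * |v - u|)
    (ha : d * φ a ≤ -(|d| * (t * (|c| + ρ)))) (hb : |d| * (t * (|c| + ρ)) ≤ d * φ b)
    (hψ : ∀ u ∈ Icc a b, |ψ u - φ u - t * c| ≤ t * ρ) :
    |volume.real (Icc a b ∩ {u | ψ u ≤ 0}) - volume.real (Icc a b ∩ {u | φ u ≤ 0})
      + t * (c / |d|)| ≤ t * (ρ / |d| + 2 * ρ * (|c| + ρ) / |d| ^ 2) := by
  rcases hd.lt_or_gt with hneg | hpos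
  · have hrefl : ∀ f : ℝ → ℝ, volume.real (Icc (-b) (-a) ∩ {u | f (-u) ≤ 0})
        = volume.real (Icc a b ∩ {u | f u ≤ 0}) := by
      intro f
      have : Icc (-b) (-a) ∩ {u | f (-u) ≤ 0} = -(Icc a b ∩ {u | f u ≤ 0}) := by
        ext u
        simp only [mem_inter_iff, mem_Icc, mem_ofPred_eq, Set.mem_neg]
        constructor <;> rintro ⟨⟨h1, h2⟩, h3⟩ <;> exact ⟨⟨by linarith, by linarith⟩, h3⟩
      rw [this, measureReal_def, measureReal_def, Measure.measure_neg]
    have hmem : ∀ u ∈ Icc (-b) (-a), -u ∈ Icc a b := fun u hu =>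
      ⟨by linarith [hu.2], by linarith [hu.1]⟩
    have hd' : 0 < |d| := abs_pos.2 hd
    have hdd : |d| = -d := abs_of_neg hneg
    rw [← hrefl φ, ← hrefl ψ]
    refine abs_measureReal_sublevel_sub_le_of_pos (φ := fun u => φ (-u)) (ψ := fun u => ψ (-u))
      (neg_le_neg hab) hd' hρ hρd ht ?_ ?_ ?_ ?_ ?_
    · exact hc.comp continuousOn_neg hmem
    · intro u hu v hv
      have := hφ (-u) (hmem u hu) (-v) (hmem v hv)
      have e : -v - -u = -(v - u) := by ring
      rw [e, abs_neg] at this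
      rw [hdd]
      have e' : φ (-v) - φ (-u) - -d * (v - u) = φ (-v) - φ (-u) - d * -(v - u) := by ring
      rwa [e']
    · simp only [neg_neg]
      have := hb
      rw [hdd] at this
      nlinarith
    · simp only [neg_neg]
      have := ha
      rw [hdd] at this
      nlinarith
    · exact fun u hu => hψ (-u) (hmem u hu)
  · rw [abs_of_pos hpos] at *
    refine abs_measureReal_sublevel_sub_le_of_pos hab hpos hρ hρd ht hc hφ ?_ ?_ hψ
    · nlinarith
    · nlinarith

/-! ### Perturbations of the curve near and away from its roots -/

/-- `q` is a measurable perturbation of `Q` in the direction `h`, of size `t` and relative error at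
most `δ`: `|q - Q - t h| ≤ δ t` on `[0,1] × X`. -/
def IsPerturbation {E : Type*} [MeasurableSpace E] (X : Set E) (Q h : ℝ → E → ℝ) (t δ : ℝ)
    (q : ℝ → E → ℝ) : Prop :=
  Measurable (fun p : domUX X => q p.1.1 p.1.2) ∧
    ∀ u ∈ Icc (0 : ℝ) 1, ∀ x ∈ X, |q u x - Q u x - t * h u x| ≤ δ * t

theorem measurable_section {E : Type*} [MeasurableSpace E] {X : Set E} {q : ℝ → E → ℝ}
    (hq : Measurable fun p : domUX X => q p.1.1 p.1.2) {x : E} (hx : x ∈ X) :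
    Measurable fun v : Icc (0 : ℝ) 1 => q v x :=
  hq.comp (g := fun p : domUX X => q p.1.1 p.1.2)
    (f := fun v : Icc (0 : ℝ) 1 => ⟨(v, x), v.2, hx⟩)
    ((measurable_subtype_coe.prodMk measurable_const).subtype_mk)

theorem continuousOn_section {E : Type*} [TopologicalSpace E] {X : Set E}
    {Q : ℝ → E → ℝ} (hQ : ContinuousOn (fun p : ℝ × E => Q p.1 p.2) (domUX X))
    {x : E} (hx : x ∈ X) : ContinuousOn (fun u => Q u x) (Icc 0 1) :=
  hQ.comp (f := fun u : ℝ => (u, x)) (by fun_prop) fun u hu => ⟨hu, hx⟩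

theorem tendsto_sub_of_continuousOn {E : Type*} [TopologicalSpace E] {X : Set E}
    {Q : ℝ → E → ℝ} (hQ : ContinuousOn (fun p : ℝ × E => Q p.1 p.2) (domUX X)) {u : ℝ}
    (hu : u ∈ Icc (0 : ℝ) 1) {x₀ : E} (hx₀ : x₀ ∈ X) (y₀ : ℝ) :
    Tendsto (fun z : ℝ × ℝ × E => Q u z.2.2 - z.2.1) (𝓝[{z | z.2.2 ∈ X}] (0, y₀, x₀))
      (𝓝 (Q u x₀ - y₀)) := by
  have h1 : ContinuousWithinAt (fun z : ℝ × ℝ × E => Q u z.2.2) {z | z.2.2 ∈ X} (0, y₀, x₀) :=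
    ContinuousWithinAt.comp (x := ((0 : ℝ), y₀, x₀)) (s := {z : ℝ × ℝ × E | z.2.2 ∈ X})
      (f := fun z : ℝ × ℝ × E => (u, z.2.2)) (g := fun p : ℝ × E => Q p.1 p.2) (t := domUX X) (hQ (u, x₀) ⟨hu, hx₀⟩)
      (Continuous.continuousWithinAt (by fun_prop)) fun z hz => ⟨hu, hz⟩
  exact Tendsto.sub h1 (Continuous.continuousWithinAt (by fun_prop))

/-- The variable `z` stands for a triple `(κ, y, x)`, here and below with a small real number in the
first place, so that one neighbourhood filter expresses closeness of `(y, x)` to `(y₀, x₀)` and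
smallness of the remaining constants. -/
theorem eventually_lt_abs_sub {E : Type*} [TopologicalSpace E] {X : Set E}
    {Q : ℝ → E → ℝ} (hQ : ContinuousOn (fun p : ℝ × E => Q p.1 p.2) (domUX X)) {J : Set ℝ}
    (hJ : IsCompact J) (hJI : J ⊆ Icc 0 1) {x₀ : E} (hx₀ : x₀ ∈ X) {y₀ : ℝ}
    (hne : ∀ u ∈ J, Q u x₀ ≠ y₀) :
    ∀ᶠ z : ℝ × ℝ × E in 𝓝 (0, y₀, x₀), ∀ u ∈ J, z.2.2 ∈ X → |z.1| < |Q u z.2.2 - z.2.1| := by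
  have h := hJ.eventually_forall_of_forall_eventually (x₀ := ((0 : ℝ), y₀, x₀))
    (P := fun z u => u ∈ Icc (0 : ℝ) 1 → z.2.2 ∈ X → |z.1| < |Q u z.2.2 - z.2.1|) ?_
  · exact h.mono fun z hz u hu => hz u hu (hJI hu)
  · intro u hu
    have h1 : ContinuousWithinAt (fun w : (ℝ × ℝ × E) × ℝ => |Q w.2 w.1.2.2 - w.1.2.1| - |w.1.1|)
        {w | (w.2, w.1.2.2) ∈ domUX X} ((0, y₀, x₀), u) := by
      have h2 : ContinuousWithinAt (fun w : (ℝ × ℝ × E) × ℝ => Q w.2 w.1.2.2)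
          {w | (w.2, w.1.2.2) ∈ domUX X} ((0, y₀, x₀), u) :=
        ContinuousWithinAt.comp (x := (((0 : ℝ), y₀, x₀), u))
          (s := {w : (ℝ × ℝ × E) × ℝ | (w.2, w.1.2.2) ∈ domUX X})
          (f := fun w : (ℝ × ℝ × E) × ℝ => (w.2, w.1.2.2)) (g := fun p : ℝ × E => Q p.1 p.2) (t := domUX X)
          (hQ (u, x₀) ⟨hJI hu, hx₀⟩)
          (Continuous.continuousWithinAt (by fun_prop)) fun z hz => hz
      exact ((h2.sub (Continuous.continuousWithinAt (by fun_prop))).abs).sub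
        (Continuous.continuousWithinAt (by fun_prop))
    have h3 : (0 : ℝ) < |Q u x₀ - y₀| - |(0 : ℝ)| := by
      rw [abs_zero, sub_zero]; exact abs_pos.2 (sub_ne_zero.2 (hne u hu))
    have h4 := eventually_nhdsWithin_iff.1 (h1.eventually_const_lt h3)
    filter_upwards [h4] with w hw hw1 hw2
    exact sub_pos.1 (hw ⟨hw1, hw2⟩)

theorem exists_abs_le {E : Type*} [TopologicalSpace E] {X : Set E} (hX : IsCompact X)
    {h : ℝ → E → ℝ} (hh : ContinuousOn (fun p : ℝ × E => h p.1 p.2) (domUX X)) :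
    ∃ H, 0 ≤ H ∧ ∀ u ∈ Icc (0 : ℝ) 1, ∀ x ∈ X, |h u x| ≤ H := by
  obtain ⟨C, hC⟩ := (isCompact_Icc.prod hX).exists_bound_of_continuousOn hh
  exact ⟨max C 0, le_max_right _ _, fun u hu x hx => le_max_of_le_left (hC (u, x) ⟨hu, hx⟩)⟩

/-- Away from the roots of `Q(·|x₀) = y₀` small perturbations do not change the side of `y`. -/
theorem eventually_le_iff_of_perturbation {E : Type*} [TopologicalSpace E] [MeasurableSpace E]
    {X : Set E} (hX : IsCompact X) {Q h : ℝ → E → ℝ}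
    (hQ : ContinuousOn (fun p : ℝ × E => Q p.1 p.2) (domUX X))
    (hh : ContinuousOn (fun p : ℝ × E => h p.1 p.2) (domUX X)) {J : Set ℝ}
    (hJ : IsCompact J) (hJI : J ⊆ Icc 0 1) {x₀ : E} (hx₀ : x₀ ∈ X) {y₀ : ℝ}
    (hne : ∀ u ∈ J, Q u x₀ ≠ y₀) :
    ∀ᶠ z : ℝ × ℝ × E in 𝓝 (0, y₀, x₀), z.2.2 ∈ X → ∀ t ∈ Ioo 0 z.1, ∀ q,
      IsPerturbation X Q h t z.1 q → ∀ u ∈ J, (q u z.2.2 ≤ z.2.1 ↔ Q u z.2.2 ≤ z.2.1) := by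
  obtain ⟨H, hH0, hH⟩ := exists_abs_le hX hh
  -- The factor `H + 1` makes the margin exceed `t (|h| + δ)`.
  have htend : Tendsto (fun z : ℝ × ℝ × E => (z.1 * (H + 1), z.2)) (𝓝 (0, y₀, x₀))
      (𝓝 (0, y₀, x₀)) := by
    have : Continuous fun z : ℝ × ℝ × E => (z.1 * (H + 1), z.2) := by fun_prop
    simpa using this.tendsto (0, y₀, x₀)
  have h1 : ∀ᶠ z : ℝ × ℝ × E in 𝓝 (0, y₀, x₀), z.1 < 1 :=
    continuous_fst.continuousAt.eventually_lt_const one_pos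
  filter_upwards [htend.eventually (eventually_lt_abs_sub hQ hJ hJI hx₀ hne), h1]
    with z hz hz1 hzX t ht q hq u hu
  have h2 := hz u hu hzX
  have h3 := abs_le.1 (hq.2 u (hJI hu) _ hzX)
  have h4 := abs_le.1 (hH u (hJI hu) _ hzX)
  have hz0 : 0 < z.1 := ht.1.trans ht.2
  rw [abs_of_pos (by positivity)] at h2
  have h5 : t * (H + 1) < z.1 * (H + 1) := by
    have := ht.2
    gcongr
  have h6 : z.1 * t ≤ 1 * t := mul_le_mul_of_nonneg_right hz1.le ht.1.le
  have h7 : t * h u z.2.2 ≤ t * H := mul_le_mul_of_nonneg_left h4.2 ht.1.le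
  have h8 : t * -H ≤ t * h u z.2.2 := mul_le_mul_of_nonneg_left h4.1 ht.1.le
  constructor <;> intro hle
  · by_contra! hlt
    rw [abs_of_pos (by linarith)] at h2
    linarith
  · rw [abs_of_nonpos (by linarith)] at h2
    linarith

theorem IsAdmissibleCurve.abs_sub_sub_mul_le {E : Type*} [TopologicalSpace E] {X : Set E}
    {Q : ℝ → E → ℝ} (hQ : IsAdmissibleCurve X Q) {x : E} (hx : x ∈ X) {a b d ρ : ℝ}
    (hab : Icc a b ⊆ Icc 0 1) (hρ : ∀ u ∈ Icc a b, |partialU Q u x - d| ≤ ρ) :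
    ∀ u ∈ Icc a b, ∀ v ∈ Icc a b, |Q v x - Q u x - d * (v - u)| ≤ ρ * |v - u| := by
  intro u hu v hv
  have hd : ∀ w ∈ Icc a b, HasDerivWithinAt (fun w => Q w x - d * w) (partialU Q w x - d)
      (Icc a b) w := by
    intro w hw
    have h1 := ((hQ.differentiableOn x hx w (hab hw)).hasDerivWithinAt).mono hab
    have h2 := ((hasDerivAt_id w).const_mul d).hasDerivWithinAt (s := Icc a b)
    rw [mul_one] at h2
    exact h1.sub h2
  have := (convex_Icc a b).norm_image_sub_le_of_norm_hasDerivWithin_le hd hρ hu hv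
  simp only [Real.norm_eq_abs] at this
  have e : Q v x - Q u x - d * (v - u) = Q v x - d * v - (Q u x - d * u) := by ring
  rwa [e]

/-- Contribution of a root `r ∈ (0,1)` to the derivative of the distribution function. In
`z = (δ, y, x)` the number `δ` bounds both the size `t` and the relative error of the
perturbation. -/
theorem eventually_abs_measureReal_near_root {E : Type*} [TopologicalSpace E] [MeasurableSpace E]
    {X : Set E} {Q h : ℝ → E → ℝ} (hQ : IsAdmissibleCurve X Q)
    (hh : ContinuousOn (fun p : ℝ × E => h p.1 p.2) (domUX X)) {x₀ : E} (hx₀ : x₀ ∈ X)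
    {r : ℝ} (hr : r ∈ Ioo (0 : ℝ) 1) (hd : partialU Q r x₀ ≠ 0) {ε : ℝ} (hε : 0 < ε) :
    ∀ᶠ η in 𝓝[>] (0 : ℝ), ∀ᶠ z : ℝ × ℝ × E in 𝓝 (0, Q r x₀, x₀), z.2.2 ∈ X → ∀ t ∈ Ioo 0 z.1,
      ∀ q, IsPerturbation X Q h t z.1 q →
        |volume.real (Icc (r - η) (r + η) ∩ {u | q u z.2.2 ≤ z.2.1})
          - volume.real (Icc (r - η) (r + η) ∩ {u | Q u z.2.2 ≤ z.2.1})
          + t * (h r x₀ / |partialU Q r x₀|)| ≤ t * ε := by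
  set d := partialU Q r x₀ with hd_def
  set c := h r x₀ with hc_def
  have hd0 : 0 < |d| := abs_pos.2 hd
  obtain ⟨ρ, ⟨hρd, hρε⟩, hρ⟩ : ∃ ρ, (2 * ρ ≤ |d| ∧
      ρ / |d| + 2 * ρ * (|c| + ρ) / |d| ^ 2 ≤ ε) ∧ 0 < ρ := by
    have h1 : ∀ᶠ ρ : ℝ in 𝓝[>] 0, 2 * ρ < |d| := by
      have : Continuous fun ρ : ℝ => 2 * ρ := by fun_prop
      exact nhdsWithin_le_nhds (this.continuousAt.eventually_lt_const (by simpa using hd))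
    have h2 : ∀ᶠ ρ : ℝ in 𝓝[>] 0, ρ / |d| + 2 * ρ * (|c| + ρ) / |d| ^ 2 < ε := by
      have : Continuous fun ρ : ℝ => ρ / |d| + 2 * ρ * (|c| + ρ) / |d| ^ 2 := by fun_prop
      exact nhdsWithin_le_nhds (this.continuousAt.eventually_lt_const (by simpa using hε))
    obtain ⟨ρ, h1, h2, h3⟩ := (h1.and (h2.and self_mem_nhdsWithin)).exists
    exact ⟨ρ, ⟨h1.le, h2.le⟩, h3⟩
  have hrx : (r, x₀) ∈ domUX X := ⟨Ioo_subset_Icc_self hr, hx₀⟩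
  have hnear : ∀ᶠ p : ℝ × E in 𝓝 (r, x₀), p ∈ domUX X →
      |partialU Q p.1 p.2 - d| < ρ ∧ |h p.1 p.2 - c| < ρ / 2 := by
    have h1 := (hQ.continuousOn_partialU _ hrx).sub (continuousWithinAt_const (b := d))
    have h2 := (hh _ hrx).sub (continuousWithinAt_const (b := c))
    refine eventually_nhdsWithin_iff.1 ((h1.abs.eventually_lt_const ?_).and
      (h2.abs.eventually_lt_const ?_))
    · simpa [← hd_def] using hρ
    · simpa [← hc_def] using hρ
  rw [nhds_prod_eq] at hnear
  obtain ⟨pa, hpa, pb, hpb, hab⟩ := eventually_prod_iff.1 hnear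
  obtain ⟨η₀, hη₀, hball⟩ := Metric.eventually_nhds_iff.1 (hpa.and (Ioo_mem_nhds hr.1 hr.2))
  have hη_small : ∀ᶠ η in 𝓝[>] (0 : ℝ), η < η₀ := nhdsWithin_le_nhds (gt_mem_nhds hη₀)
  filter_upwards [hη_small, self_mem_nhdsWithin] with η hη (hη0 : 0 < η)
  have hI : ∀ u ∈ Icc (r - η) (r + η), pa u ∧ u ∈ Ioo (0 : ℝ) 1 := fun u hu => hball <| by
    rw [Real.dist_eq]
    exact lt_of_le_of_lt (abs_le.2 ⟨by linarith [hu.1], by linarith [hu.2]⟩) hη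
  have hI01 : Icc (r - η) (r + η) ⊆ Icc 0 1 := fun u hu => Ioo_subset_Icc_self (hI u hu).2
  have hl : r - η ∈ Icc (r - η) (r + η) := ⟨le_rfl, by linarith⟩
  have hm : r ∈ Icc (r - η) (r + η) := ⟨by linarith, by linarith⟩
  have hu : r + η ∈ Icc (r - η) (r + η) := ⟨by linarith, le_rfl⟩
  have hslope : ∀ x ∈ X, pb x → ∀ u ∈ Icc (r - η) (r + η), ∀ v ∈ Icc (r - η) (r + η),
      |Q v x - Q u x - d * (v - u)| ≤ ρ * |v - u| := fun x hx hbx =>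
    hQ.abs_sub_sub_mul_le hx hI01 fun u hu => (hab (hI u hu).1 hbx ⟨hI01 hu, hx⟩).1.le
  have hb₀ : pb x₀ := hpb.self_of_nhds
  have hdsq : d * d = |d| * |d| := (abs_mul_abs_self d).symm
  -- The margin by which `Q(·|x₀) - Q(r|x₀)` changes sign over the interval.
  have hleft : d * (Q (r - η) x₀ - Q r x₀) < -(|d| * (|d| * η / 4)) := by
    have h1 := hslope x₀ hx₀ hb₀ r hm (r - η) hl
    have e : r - η - r = -η := by ring
    rw [e, abs_neg, abs_of_pos hη0] at h1
    have h2 : |d * (Q (r - η) x₀ - Q r x₀ - d * -η)| ≤ |d| * (ρ * η) := by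
      rw [abs_mul]; gcongr
    have h3 := (abs_le.1 h2).2
    have h4 : |d| * (2 * ρ * η) ≤ |d| * (|d| * η) := by gcongr
    have h5 : 0 < |d| * (|d| * η) := by positivity
    have h6 : d * d * η = |d| * (|d| * η) := by rw [hdsq]; ring
    linarith
  have hright : |d| * (|d| * η / 4) < d * (Q (r + η) x₀ - Q r x₀) := by
    have h1 := hslope x₀ hx₀ hb₀ r hm (r + η) hu
    have e : r + η - r = η := by ring
    rw [e, abs_of_pos hη0] at h1
    have h2 : |d * (Q (r + η) x₀ - Q r x₀ - d * η)| ≤ |d| * (ρ * η) := by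
      rw [abs_mul]; gcongr
    have h3 := (abs_le.1 h2).1
    have h4 : |d| * (2 * ρ * η) ≤ |d| * (|d| * η) := by gcongr
    have h5 : 0 < |d| * (|d| * η) := by positivity
    have h6 : d * d * η = |d| * (|d| * η) := by rw [hdsq]; ring
    linarith
  have evl := eventually_nhdsWithin_iff.1
    (((tendsto_sub_of_continuousOn hQ.continuousOn (hI01 hl) hx₀ (Q r x₀)).const_mul d
      ).eventually_lt_const hleft)
  have evr := eventually_nhdsWithin_iff.1
    (((tendsto_sub_of_continuousOn hQ.continuousOn (hI01 hu) hx₀ (Q r x₀)).const_mul d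
      ).eventually_const_lt hright)
  have evb : ∀ᶠ z : ℝ × ℝ × E in 𝓝 (0, Q r x₀, x₀), pb z.2.2 :=
    (continuous_snd.comp continuous_snd).continuousAt.eventually hpb
  have evρ : ∀ᶠ z : ℝ × ℝ × E in 𝓝 (0, Q r x₀, x₀), z.1 < ρ / 2 :=
    continuous_fst.continuousAt.eventually_lt_const (by simpa using hρ)
  have evB : ∀ᶠ z : ℝ × ℝ × E in 𝓝 (0, Q r x₀, x₀), z.1 * (|c| + ρ) < |d| * η / 4 := by
    have : Continuous fun z : ℝ × ℝ × E => z.1 * (|c| + ρ) := by fun_prop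
    refine this.continuousAt.eventually_lt_const ?_
    simp only [zero_mul]
    positivity
  filter_upwards [evl, evr, evb, evρ, evB] with z hzl hzr hzb hzρ hzB hzX t ht q hq
  have htB : |d| * (t * (|c| + ρ)) ≤ |d| * (|d| * η / 4) := by
    have : t * (|c| + ρ) ≤ z.1 * (|c| + ρ) := by have := ht.2.le; gcongr
    gcongr
    linarith
  have key := abs_measureReal_sublevel_sub_le (a := r - η) (b := r + η) (d := d) (ρ := ρ) (t := t)
    (c := c) (φ := fun u => Q u z.2.2 - z.2.1) (ψ := fun u => q u z.2.2 - z.2.1)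
    (by linarith) hd hρ hρd ht.1
    (((continuousOn_section hQ.continuousOn hzX).mono hI01).sub continuousOn_const)
    (fun u hu v hv => by
      have := hslope _ hzX hzb u hu v hv
      have e : Q v z.2.2 - z.2.1 - (Q u z.2.2 - z.2.1) = Q v z.2.2 - Q u z.2.2 := by ring
      rwa [e])
    ((hzl hzX).le.trans (by linarith)) (htB.trans (hzr hzX).le)
    (fun u hu => by
      have h1 := abs_le.1 (hq.2 u (hI01 hu) _ hzX)
      have h2 := abs_le.1 (hab (hI u hu).1 hzb ⟨hI01 hu, hzX⟩).2.le
      have h3 : z.1 * t ≤ ρ / 2 * t := mul_le_mul_of_nonneg_right hzρ.le ht.1.le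
      have h4 : t * (h u z.2.2 - c) ≤ t * (ρ / 2) := mul_le_mul_of_nonneg_left h2.2 ht.1.le
      have h5 : t * -(ρ / 2) ≤ t * (h u z.2.2 - c) := mul_le_mul_of_nonneg_left h2.1 ht.1.le
      exact abs_le.2 ⟨by linarith, by linarith⟩)
  simp only [sub_nonpos] at key
  exact key.trans (mul_le_mul_of_nonneg_left hρε ht.1.le)

/-! ### Local expansion of the distribution function -/

/-- Roots with nonvanishing derivative are isolated, and the set of roots is compact. -/
theorem IsAdmissibleCurve.finite_rootSet {E : Type*} [TopologicalSpace E] {X : Set E}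
    {Q : ℝ → E → ℝ} (hQ : IsAdmissibleCurve X Q) {x : E} (hx : x ∈ X) {y : ℝ}
    (hy : y ∈ regularValues Q x) : (rootSet Q y x).Finite := by
  by_contra hinf
  have hcl : IsClosed (rootSet Q y x) :=
    (continuousOn_section hQ.continuousOn hx).preimage_isClosed_of_isClosed isClosed_Icc
      (isClosed_singleton (x := y))
  have hcpt : IsCompact (rootSet Q y x) := isCompact_Icc.of_isClosed_subset hcl fun u hu => hu.1
  obtain ⟨r, hr, hacc⟩ := Set.Infinite.exists_accPt_of_subset_isCompact hinf hcpt Subset.rfl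
  have hder := (hQ.differentiableOn x hx r hr.1).hasDerivWithinAt
  have hne := hder.eventually_ne (c := y) (hy.2 r hr)
  rw [eventually_nhdsWithin_iff] at hne
  obtain ⟨u, ⟨hur, huR⟩, hu⟩ := ((accPt_iff_frequently.1 hacc).and_eventually hne).exists
  exact hu ⟨huR.1, hur⟩ huR.2

theorem derivF_eq_sum {E : Type*} {Q h : ℝ → E → ℝ} {y : ℝ} {x : E}
    (hfin : (rootSet Q y x).Finite) :
    derivF Q h y x = -∑ r ∈ hfin.toFinset, h r x / |partialU Q r x| := by
  rw [derivF, finsum_mem_eq_finite_toFinset_sum _ hfin]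

theorem densF_eq_sum {E : Type*} {Q : ℝ → E → ℝ} {y : ℝ} {x : E}
    (hfin : (rootSet Q y x).Finite) (hy : y ∈ regularValues Q x) :
    densF Q y x = ∑ r ∈ hfin.toFinset, 1 / |partialU Q r x| := by
  rw [densF, indicator_of_mem hy, finsum_mem_eq_finite_toFinset_sum _ hfin]

theorem densF_pos {E : Type*} {Q : ℝ → E → ℝ} {y : ℝ} {x : E}
    (hfin : (rootSet Q y x).Finite) (hy : y ∈ regularValues Q x) : 0 < densF Q y x := by
  rw [densF_eq_sum hfin hy]
  refine Finset.sum_pos (fun r hr => ?_) (hfin.toFinset_nonempty.2 hy.1)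
  have := abs_pos.2 (hy.2 r (hfin.mem_toFinset.1 hr))
  positivity

theorem derivF_sub_const {E : Type*} {Q h : ℝ → E → ℝ} {y : ℝ} {x : E}
    (hfin : (rootSet Q y x).Finite) (hy : y ∈ regularValues Q x) (k : ℝ) :
    derivF Q (fun u x => h u x - k) y x = derivF Q h y x + k * densF Q y x := by
  rw [derivF_eq_sum hfin, derivF_eq_sum hfin, densF_eq_sum hfin hy, Finset.mul_sum,
    ← sub_eq_zero, neg_add_eq_sub, sub_eq_neg_add, neg_sub]
  simp only [sub_div, Finset.sum_sub_distrib, mul_one_div]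
  ring

theorem continuousOn_measurable_section {f : ℝ → ℝ} (hf : ContinuousOn f (Icc 0 1)) :
    Measurable fun v : Icc (0 : ℝ) 1 => f v :=
  (continuousOn_iff_continuous_domRestrict.1 hf).measurable

/-- Expansion of the distribution function near `(y₀, x₀)`, with `z = (δ, y, x)`. The derivative is
the one at the centre `(y₀, x₀)`, not at `(y, x)`. -/
theorem eventually_abs_distFun_sub {E : Type*} [TopologicalSpace E] [MeasurableSpace E]
    {X : Set E} (hX : IsCompact X) {Q h : ℝ → E → ℝ} (hQ : IsAdmissibleCurve X Q)
    (hh : ContinuousOn (fun p : ℝ × E => h p.1 p.2) (domUX X)) {x₀ : E} (hx₀ : x₀ ∈ X) {y₀ : ℝ}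
    (hy₀ : y₀ ∈ regularValues Q x₀) (hends : Q 0 x₀ ≠ y₀ ∧ Q 1 x₀ ≠ y₀) {ε : ℝ} (hε : 0 < ε) :
    ∀ᶠ z : ℝ × ℝ × E in 𝓝 (0, y₀, x₀), z.2.2 ∈ X → ∀ t ∈ Ioo 0 z.1, ∀ q,
      IsPerturbation X Q h t z.1 q →
        |distFun q z.2.1 z.2.2 - distFun Q z.2.1 z.2.2 - t * derivF Q h y₀ x₀| ≤ t * ε := by
  have hfin := hQ.finite_rootSet hx₀ hy₀
  set R := hfin.toFinset with hR
  have hRmem : ∀ r ∈ R, r ∈ Ioo (0 : ℝ) 1 ∧ Q r x₀ = y₀ ∧ partialU Q r x₀ ≠ 0 := by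
    intro r hr
    have hr' := hfin.mem_toFinset.1 hr
    refine ⟨⟨hr'.1.1.lt_of_ne ?_, hr'.1.2.lt_of_ne ?_⟩, hr'.2, hy₀.2 r hr'⟩
    · rintro rfl; exact hends.1 hr'.2
    · rintro rfl; exact hends.2 hr'.2
  set ε' := ε / (R.card + 1) with hε'
  have hε'0 : 0 < ε' := by positivity
  have hpieces : ∀ᶠ η in 𝓝[>] (0 : ℝ), ∀ r ∈ R, ∀ᶠ z : ℝ × ℝ × E in 𝓝 (0, y₀, x₀), z.2.2 ∈ X →
      ∀ t ∈ Ioo 0 z.1, ∀ q, IsPerturbation X Q h t z.1 q →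
        |volume.real (Icc (r - η) (r + η) ∩ {u | q u z.2.2 ≤ z.2.1})
          - volume.real (Icc (r - η) (r + η) ∩ {u | Q u z.2.2 ≤ z.2.1})
          + t * (h r x₀ / |partialU Q r x₀|)| ≤ t * ε' := by
    rw [Finset.eventually_all]
    intro r hr
    obtain ⟨h1, h2, h3⟩ := hRmem r hr
    simpa only [h2] using eventually_abs_measureReal_near_root hQ hh hx₀ h1 h3 hε'0
  have hdisj : ∀ᶠ η in 𝓝[>] (0 : ℝ), ∀ r ∈ R, ∀ r' ∈ R, r ≠ r' → 2 * η < |r - r'| := by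
    rw [Finset.eventually_all]
    intro r hr
    rw [Finset.eventually_all]
    intro r' hr'
    by_cases hrr : r = r'
    · exact Eventually.of_forall fun η h => absurd hrr h
    · have : Continuous fun η : ℝ => 2 * η := by fun_prop
      have h1 : ∀ᶠ η : ℝ in 𝓝[>] 0, 2 * η < |r - r'| :=
        nhdsWithin_le_nhds (this.continuousAt.eventually_lt_const
          (by simpa using sub_ne_zero.2 hrr))
      exact h1.mono fun η hη _ => hη
  have hinside : ∀ᶠ η in 𝓝[>] (0 : ℝ), ∀ r ∈ R, η < r ∧ η < 1 - r := by
    rw [Finset.eventually_all]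
    intro r hr
    have h1 := (hRmem r hr).1
    exact nhdsWithin_le_nhds ((gt_mem_nhds h1.1).and (gt_mem_nhds (sub_pos.2 h1.2)))
  obtain ⟨η, hη1, hη2, hη3, hη0⟩ :=
    (hpieces.and (hdisj.and (hinside.and self_mem_nhdsWithin))).exists
  have hη0 : 0 < η := hη0
  -- Off the intervals there are no roots, and perturbations leave the sublevel set unchanged.
  set J : Set ℝ := Icc 0 1 \ ⋃ r ∈ R, Ioo (r - η) (r + η) with hJ
  have hJc : IsCompact J := isCompact_Icc.diff (isOpen_biUnion fun _ _ => isOpen_Ioo)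
  have hJne : ∀ u ∈ J, Q u x₀ ≠ y₀ := by
    rintro u ⟨hu, hu'⟩ hQu
    exact hu' (mem_iUnion₂.2 ⟨u, hfin.mem_toFinset.2 ⟨hu, hQu⟩, by linarith, by linarith⟩)
  have haway := eventually_le_iff_of_perturbation hX hQ.continuousOn hh hJc
    (fun u hu => hu.1) hx₀ hJne
  filter_upwards [haway, (Finset.eventually_all R).2 hη1] with z hzJ hzR hzX t ht q hq
  have hqm := measurable_section hq.1 hzX
  have hQm := continuousOn_measurable_section (continuousOn_section hQ.continuousOn hzX)
  have hIsub : ∀ r ∈ R, Icc (r - η) (r + η) ⊆ Icc 0 1 := fun r hr u hu =>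
    ⟨by linarith [hu.1, (hη3 r hr).1], by linarith [hu.2, (hη3 r hr).2]⟩
  have hIinter : ∀ r ∈ R, ∀ A : Set ℝ, Icc (r - η) (r + η) ∩ (Icc 0 1 ∩ A)
      = Icc (r - η) (r + η) ∩ A := fun r hr A => by
    rw [← inter_assoc, inter_eq_left.2 (hIsub r hr)]
  have hsum := measureReal_sub_eq_sum (μ := volume) (R := R) (I := fun r => Icc (r - η) (r + η))
    (A := Icc 0 1 ∩ {v | q v z.2.2 ≤ z.2.1}) (B := Icc 0 1 ∩ {v | Q v z.2.2 ≤ z.2.1})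
    (fun _ => measurableSet_Icc)
    (fun r hr r' hr' hne => Set.disjoint_left.2 fun u hu hu' => by
      have h1 := hη2 r hr r' hr' hne
      have h2 : |r - r'| ≤ 2 * η :=
        abs_le.2 ⟨by linarith [hu.1, hu.2, hu'.1, hu'.2], by linarith [hu.1, hu.2, hu'.1, hu'.2]⟩
      linarith)
    (measure_ne_top_of_subset inter_subset_left (by simp))
    (measure_ne_top_of_subset inter_subset_left (by simp))
    (by
      ext u
      have : u ∈ Icc (0 : ℝ) 1 → u ∉ ⋃ r ∈ R, Icc (r - η) (r + η) →
          (q u z.2.2 ≤ z.2.1 ↔ Q u z.2.2 ≤ z.2.1) := fun hu hu' =>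
        hzJ hzX t ht q hq u ⟨hu, fun hmem => hu' (iUnion₂_mono
          (fun r _ => Ioo_subset_Icc_self) hmem)⟩
      constructor
      · rintro ⟨⟨h1, h2⟩, h3⟩
        exact ⟨⟨h1, (this h1 h3).1 h2⟩, h3⟩
      · rintro ⟨⟨h1, h2⟩, h3⟩
        exact ⟨⟨h1, (this h1 h3).2 h2⟩, h3⟩)
    (measurableSet_sublevel (f := fun v => q v z.2.2) hqm z.2.1)
    (measurableSet_sublevel (f := fun v => Q v z.2.2) hQm z.2.1)
  rw [distFun_eq_measureReal hqm, distFun_eq_measureReal hQm, hsum, derivF_eq_sum hfin, mul_neg,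
    sub_neg_eq_add, Finset.mul_sum, ← Finset.sum_add_distrib]
  calc _ ≤ ∑ r ∈ R, t * ε' := by
        refine (Finset.abs_sum_le_sum_abs _ _).trans (Finset.sum_le_sum fun r hr => ?_)
        rw [hIinter r hr, hIinter r hr]
        exact hzR r hr hzX t ht q hq
    _ = t * (R.card * ε') := by rw [Finset.sum_const, nsmul_eq_mul]; ring
    _ ≤ t * ε := by
        refine mul_le_mul_of_nonneg_left ?_ ht.1.le
        rw [hε', mul_div_assoc', div_le_iff₀ (by positivity)]
        nlinarith

/-! ### Local expansion of the rearrangement -/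

theorem distFun_add {E : Type*} (q : ℝ → E → ℝ) (y k : ℝ) (x : E) :
    distFun q (y + k) x = distFun (fun u x => q u x - k) y x := by
  simp only [distFun, sub_le_iff_le_add]

theorem IsPerturbation.sub_const {E : Type*} [MeasurableSpace E] {X : Set E} {Q h q : ℝ → E → ℝ}
    {t δ : ℝ} (hq : IsPerturbation X Q h t δ q) (k : ℝ) :
    IsPerturbation X Q (fun u x => h u x - k) t δ (fun u x => q u x - t * k) := by
  refine ⟨hq.1.sub_const _, fun u hu x hx => ?_⟩
  have e : q u x - t * k - Q u x - t * (h u x - k) = q u x - Q u x - t * h u x := by ring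
  rw [e]
  exact hq.2 u hu x hx

theorem distFun_le_of_forall {E : Type*} {q q' : ℝ → E → ℝ} {x : E}
    (hq : Measurable fun v : Icc (0 : ℝ) 1 => q v x)
    (hq' : Measurable fun v : Icc (0 : ℝ) 1 => q' v x) {y y' : ℝ}
    (h : ∀ u ∈ Icc (0 : ℝ) 1, q u x ≤ y → q' u x ≤ y') : distFun q y x ≤ distFun q' y' x := by
  rw [distFun_eq_measureReal hq, distFun_eq_measureReal hq']
  exact measureReal_mono (fun u hu => ⟨hu.1, h u hu.1 hu.2⟩)
    (measure_ne_top_of_subset inter_subset_left (by simp))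

/-- Comparison of `F_q` with a shift of `F_Q` by `t c`, `c = D̃`, near a regular value that is not
attained at the endpoints. -/
theorem eventually_distFun_bracket_of_ends {E : Type*} [TopologicalSpace E] [MeasurableSpace E]
    {X : Set E} (hX : IsCompact X) {Q h : ℝ → E → ℝ} (hQ : IsAdmissibleCurve X Q)
    (hh : ContinuousOn (fun p : ℝ × E => h p.1 p.2) (domUX X)) {x₀ : E} (hx₀ : x₀ ∈ X) {y₀ : ℝ}
    (hy₀ : y₀ ∈ regularValues Q x₀) (hends : Q 0 x₀ ≠ y₀ ∧ Q 1 x₀ ≠ y₀) {ε : ℝ} (hε : 0 < ε) :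
    ∀ᶠ z : ℝ × ℝ × E in 𝓝 (0, y₀, x₀), z.2.2 ∈ X → ∀ t ∈ Ioo 0 z.1, ∀ q,
      IsPerturbation X Q h t z.1 q →
        distFun Q z.2.1 z.2.2
          ≤ distFun q (z.2.1 + t * (-(1 / densF Q y₀ x₀) * derivF Q h y₀ x₀ + ε)) z.2.2 ∧
        distFun q (z.2.1 + t * (-(1 / densF Q y₀ x₀) * derivF Q h y₀ x₀ - ε)) z.2.2
          ≤ distFun Q z.2.1 z.2.2 := by
  have hfin := hQ.finite_rootSet hx₀ hy₀
  have hf := densF_pos hfin hy₀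
  -- The constant `c` is such that `D_{h - c}` vanishes at `(y₀, x₀)`.
  set c := -(1 / densF Q y₀ x₀) * derivF Q h y₀ x₀ with hc
  have hcf : c * densF Q y₀ x₀ = -derivF Q h y₀ x₀ := by rw [hc]; field_simp
  have hεf : 0 < ε * densF Q y₀ x₀ := by positivity
  filter_upwards [
    eventually_abs_distFun_sub (h := fun u x => h u x - (c + ε)) hX hQ
      (hh.sub continuousOn_const) hx₀ hy₀ hends hεf,
    eventually_abs_distFun_sub (h := fun u x => h u x - (c - ε)) hX hQ
      (hh.sub continuousOn_const) hx₀ hy₀ hends hεf]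
    with z hz1 hz2 hzX t ht q hq
  have h1 := hz1 hzX t ht _ (hq.sub_const (c + ε))
  have h2 := hz2 hzX t ht _ (hq.sub_const (c - ε))
  rw [derivF_sub_const hfin hy₀] at h1 h2
  rw [distFun_add, distFun_add]
  have e1 : derivF Q h y₀ x₀ + (c + ε) * densF Q y₀ x₀ = ε * densF Q y₀ x₀ := by linarith
  have e2 : derivF Q h y₀ x₀ + (c - ε) * densF Q y₀ x₀ = -(ε * densF Q y₀ x₀) := by linarith
  rw [e1] at h1
  rw [e2] at h2
  exact ⟨by linarith [(abs_le.1 h1).1], by linarith [(abs_le.1 h2).2]⟩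

/-- Comparison of `F_q` with a shift of `F_Q` by `t h(r|x₀)`, near a value attained at the single point
`r`, which may be an endpoint. No differentiability is involved. -/
theorem eventually_distFun_bracket_of_unique {E : Type*} [TopologicalSpace E] [MeasurableSpace E]
    {X : Set E} (hX : IsCompact X) {Q h : ℝ → E → ℝ}
    (hQ : ContinuousOn (fun p : ℝ × E => Q p.1 p.2) (domUX X))
    (hh : ContinuousOn (fun p : ℝ × E => h p.1 p.2) (domUX X)) {x₀ : E} (hx₀ : x₀ ∈ X) {y₀ r : ℝ}
    (hr : rootSet Q y₀ x₀ = {r}) {ε : ℝ} (hε : 0 < ε) :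
    ∀ᶠ z : ℝ × ℝ × E in 𝓝 (0, y₀, x₀), z.2.2 ∈ X → ∀ t ∈ Ioo 0 z.1, ∀ q,
      IsPerturbation X Q h t z.1 q →
        distFun Q z.2.1 z.2.2 ≤ distFun q (z.2.1 + t * (h r x₀ + ε)) z.2.2 ∧
        distFun q (z.2.1 + t * (h r x₀ - ε)) z.2.2 ≤ distFun Q z.2.1 z.2.2 := by
  set c := h r x₀ with hc_def
  have hrR : r ∈ rootSet Q y₀ x₀ := hr ▸ mem_singleton r
  have hnear : ∀ᶠ p : ℝ × E in 𝓝 (r, x₀), p ∈ domUX X → |h p.1 p.2 - c| < ε / 2 := by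
    have h2 := (hh (r, x₀) ⟨hrR.1, hx₀⟩).sub (continuousWithinAt_const (b := c))
    refine eventually_nhdsWithin_iff.1 (h2.abs.eventually_lt_const ?_)
    simpa [← hc_def] using hε
  rw [nhds_prod_eq] at hnear
  obtain ⟨pa, hpa, pb, hpb, hab⟩ := eventually_prod_iff.1 hnear
  obtain ⟨U, hU, hUo, hrU⟩ := eventually_nhds_iff.1 hpa
  have hJc : IsCompact (Icc (0 : ℝ) 1 \ U) := isCompact_Icc.diff hUo
  have hJne : ∀ u ∈ Icc (0 : ℝ) 1 \ U, Q u x₀ ≠ y₀ := by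
    rintro u ⟨hu, hu'⟩ hQu
    have : u ∈ rootSet Q y₀ x₀ := ⟨hu, hQu⟩
    rw [hr, mem_singleton_iff] at this
    exact hu' (this ▸ hrU)
  have evb : ∀ᶠ z : ℝ × ℝ × E in 𝓝 (0, y₀, x₀), pb z.2.2 :=
    (continuous_snd.comp continuous_snd).continuousAt.eventually hpb
  have evε : ∀ᶠ z : ℝ × ℝ × E in 𝓝 (0, y₀, x₀), z.1 < ε / 2 :=
    continuous_fst.continuousAt.eventually_lt_const (by simpa using hε)
  filter_upwards [
    eventually_le_iff_of_perturbation (h := fun u x => h u x - (c + ε)) hX hQ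
      (hh.sub continuousOn_const) hJc sdiff_subset hx₀ hJne,
    eventually_le_iff_of_perturbation (h := fun u x => h u x - (c - ε)) hX hQ
      (hh.sub continuousOn_const) hJc sdiff_subset hx₀ hJne, evb, evε] with z hz1 hz2 hzb hzε hzX t ht q hq
  have hq1 := hq.sub_const (c + ε)
  have hq2 := hq.sub_const (c - ε)
  have hQm := continuousOn_measurable_section (continuousOn_section hQ hzX)
  have hU' : ∀ u ∈ Icc (0 : ℝ) 1, u ∈ U →
      Q u z.2.2 + t * (c - ε) ≤ q u z.2.2 ∧ q u z.2.2 ≤ Q u z.2.2 + t * (c + ε) := by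
    intro u hu huU
    have h1 := abs_le.1 (hq.2 u hu _ hzX)
    have h2 := abs_le.1 (hab (hU u huU) hzb ⟨hu, hzX⟩).le
    have h3 : z.1 * t ≤ ε / 2 * t := mul_le_mul_of_nonneg_right hzε.le ht.1.le
    have h4 : t * (h u z.2.2 - c) ≤ t * (ε / 2) := mul_le_mul_of_nonneg_left h2.2 ht.1.le
    have h5 : t * -(ε / 2) ≤ t * (h u z.2.2 - c) := mul_le_mul_of_nonneg_left h2.1 ht.1.le
    exact ⟨by linarith, by linarith⟩
  rw [distFun_add, distFun_add]
  constructor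
  · refine distFun_le_of_forall hQm (measurable_section hq1.1 hzX) fun u hu hle => ?_
    by_cases huU : u ∈ U
    · linarith [(hU' u hu huU).2]
    · exact (hz1 hzX t ht _ hq1 u ⟨hu, huU⟩).2 hle
  · refine distFun_le_of_forall (measurable_section hq2.1 hzX) hQm fun u hu hle => ?_
    by_cases huU : u ∈ U
    · linarith [(hU' u hu huU).1]
    · exact (hz2 hzX t ht _ hq2 u ⟨hu, huU⟩).1 hle

theorem neg_inv_densF_mul_derivF_of_unique {E : Type*} {Q h : ℝ → E → ℝ} {y r : ℝ} {x : E}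
    (hr : rootSet Q y x = {r}) (hy : y ∈ regularValues Q x) :
    -(1 / densF Q y x) * derivF Q h y x = h r x := by
  have hd : |partialU Q r x| ≠ 0 := abs_ne_zero.2 (hy.2 r (hr ▸ mem_singleton r))
  rw [densF, indicator_of_mem hy, derivF, hr, finsum_mem_singleton, finsum_mem_singleton]
  field_simp

theorem distFun_mono {E : Type*} {q : ℝ → E → ℝ} {x : E}
    (hq : Measurable fun v : Icc (0 : ℝ) 1 => q v x) : Monotone fun y => distFun q y x :=
  fun _ _ hy => distFun_le_of_forall hq hq fun _ _ h => h.trans hy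

theorem distFun_of_le {E : Type*} {q : ℝ → E → ℝ} {x : E}
    (hq : Measurable fun v : Icc (0 : ℝ) 1 => q v x) {y : ℝ}
    (h : ∀ u ∈ Icc (0 : ℝ) 1, q u x ≤ y) : distFun q y x = 1 := by
  have : Icc (0 : ℝ) 1 ∩ {v | q v x ≤ y} = Icc 0 1 := inter_eq_left.2 h
  rw [distFun_eq_measureReal hq, this]
  simp

theorem distFun_of_lt {E : Type*} {q : ℝ → E → ℝ} {x : E}
    (hq : Measurable fun v : Icc (0 : ℝ) 1 => q v x) {y : ℝ}
    (h : ∀ u ∈ Icc (0 : ℝ) 1, y < q u x) : distFun q y x = 0 := by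
  have : Icc (0 : ℝ) 1 ∩ {v | q v x ≤ y} = ∅ :=
    eq_empty_of_forall_notMem fun u hu => (h u hu.1).not_ge hu.2
  rw [distFun_eq_measureReal hq, this, measureReal_empty]

theorem mem_rearrangement_set {E : Type*} {q : ℝ → E → ℝ} {x : E}
    (hq : Measurable fun v : Icc (0 : ℝ) 1 => q v x) {C : ℝ}
    (hC : ∀ u ∈ Icc (0 : ℝ) 1, |q u x| ≤ C) {u : ℝ} (hu : u ≤ 1) :
    C ∈ {y : ℝ | u ≤ distFun q y x ∧ 0 < distFun q y x} := by
  have := distFun_of_le hq fun u hu => (abs_le.1 (hC u hu)).2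
  simp [this, hu]

theorem neg_le_of_mem_rearrangement_set {E : Type*} {q : ℝ → E → ℝ} {x : E}
    (hq : Measurable fun v : Icc (0 : ℝ) 1 => q v x) {C : ℝ}
    (hC : ∀ u ∈ Icc (0 : ℝ) 1, |q u x| ≤ C) {u y : ℝ}
    (hy : y ∈ {y : ℝ | u ≤ distFun q y x ∧ 0 < distFun q y x}) : -C ≤ y := by
  by_contra! hlt
  exact hy.2.ne' (distFun_of_lt hq fun u hu => hlt.trans_le (abs_le.1 (hC u hu)).1)

theorem abs_rearrangement_le {E : Type*} {q : ℝ → E → ℝ} {x : E}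
    (hq : Measurable fun v : Icc (0 : ℝ) 1 => q v x) {C : ℝ}
    (hC : ∀ u ∈ Icc (0 : ℝ) 1, |q u x| ≤ C) {u : ℝ} (hu : u ≤ 1) :
    |rearrangement q u x| ≤ C :=
  abs_le.2 ⟨le_csInf ⟨C, mem_rearrangement_set hq hC hu⟩
      fun _ hy => neg_le_of_mem_rearrangement_set hq hC hy,
    csInf_le ⟨-C, fun _ hy => neg_le_of_mem_rearrangement_set hq hC hy⟩
      (mem_rearrangement_set hq hC hu)⟩

theorem rearrangement_lt_iff {E : Type*} {q : ℝ → E → ℝ} {x : E}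
    (hq : Measurable fun v : Icc (0 : ℝ) 1 => q v x) {C : ℝ}
    (hC : ∀ u ∈ Icc (0 : ℝ) 1, |q u x| ≤ C) {u : ℝ} (hu : u ≤ 1) (y : ℝ) :
    rearrangement q u x < y ↔ ∃ r : ℚ, (r : ℝ) < y ∧ u ≤ distFun q r x ∧ 0 < distFun q r x := by
  rw [rearrangement, csInf_lt_iff ⟨-C, fun _ hy => neg_le_of_mem_rearrangement_set hq hC hy⟩
    ⟨C, mem_rearrangement_set hq hC hu⟩]
  constructor
  · rintro ⟨s, hs, hsy⟩
    obtain ⟨r, hsr, hry⟩ := exists_rat_btwn hsy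
    have := distFun_mono hq hsr.le
    exact ⟨r, hry, hs.1.trans this, hs.2.trans_le this⟩
  · rintro ⟨r, hry, hr⟩
    exact ⟨r, hr, hry⟩

theorem rearrangement_le_add {E : Type*} {q q' : ℝ → E → ℝ} {x : E}
    (hq : Measurable fun v : Icc (0 : ℝ) 1 => q v x)
    (hq' : Measurable fun v : Icc (0 : ℝ) 1 => q' v x) {C C' : ℝ}
    (hC : ∀ u ∈ Icc (0 : ℝ) 1, |q u x| ≤ C) (hC' : ∀ u ∈ Icc (0 : ℝ) 1, |q' u x| ≤ C')
    {u k : ℝ} (hu : u ≤ 1)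
    (h : ∀ᶠ y in 𝓝[>] rearrangement q u x, distFun q y x ≤ distFun q' (y + k) x) :
    rearrangement q' u x ≤ rearrangement q u x + k := by
  have htend : Tendsto (fun y => y + k) (𝓝[>] rearrangement q u x)
      (𝓝 (rearrangement q u x + k)) :=
    (Continuous.tendsto (by fun_prop) _).mono_left nhdsWithin_le_nhds
  refine ge_of_tendsto htend ?_
  filter_upwards [h, self_mem_nhdsWithin] with y hy hlt
  obtain ⟨r, hry, hr⟩ := (rearrangement_lt_iff hq hC hu y).1 hlt
  have h1 := (distFun_mono hq hry.le).trans hy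
  exact csInf_le ⟨-C', fun _ hy => neg_le_of_mem_rearrangement_set hq' hC' hy⟩
    ⟨hr.1.trans h1, hr.2.trans_le h1⟩

theorem add_le_rearrangement {E : Type*} {q q' : ℝ → E → ℝ} {x : E}
    (hq : Measurable fun v : Icc (0 : ℝ) 1 => q v x)
    (hq' : Measurable fun v : Icc (0 : ℝ) 1 => q' v x) {C C' : ℝ}
    (hC : ∀ u ∈ Icc (0 : ℝ) 1, |q u x| ≤ C) (hC' : ∀ u ∈ Icc (0 : ℝ) 1, |q' u x| ≤ C')
    {u k : ℝ} (hu : u ≤ 1)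
    (h : ∀ᶠ y in 𝓝[<] rearrangement q u x, distFun q' (y + k) x ≤ distFun q y x) :
    rearrangement q u x + k ≤ rearrangement q' u x := by
  have htend : Tendsto (fun y => y + k) (𝓝[<] rearrangement q u x)
      (𝓝 (rearrangement q u x + k)) :=
    (Continuous.tendsto (by fun_prop) _).mono_left nhdsWithin_le_nhds
  refine le_of_tendsto htend ?_
  filter_upwards [h, self_mem_nhdsWithin] with y hy (hlt : y < _)
  refine le_csInf ⟨C', mem_rearrangement_set hq' hC' hu⟩ fun s hs => ?_
  by_contra! hsy
  have h1 := (distFun_mono hq' hsy.le).trans hy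
  exact hlt.not_ge (csInf_le ⟨-C, fun _ hy => neg_le_of_mem_rearrangement_set hq hC hy⟩
    ⟨hs.1.trans h1, hs.2.trans_le h1⟩)

/-- Expansion of the rearrangement at the points `(u, x)` with `Q^*(u|x) = y`, for `z = (δ, y, x)` near
`(0, p₀)`. The comparisons `hbr` are used at `(y', x)` with `y'` close to `y` on either side. -/
theorem eventually_abs_rearrangement_sub {E : Type*} [TopologicalSpace E] [MeasurableSpace E]
    {X : Set E} (hX : IsCompact X) {Q h : ℝ → E → ℝ}
    (hQ : ContinuousOn (fun p : ℝ × E => Q p.1 p.2) (domUX X))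
    (hh : ContinuousOn (fun p : ℝ × E => h p.1 p.2) (domUX X)) {p₀ : ℝ × E} {c ε : ℝ}
    (hbr : ∀ᶠ z : ℝ × ℝ × E in 𝓝 (0, p₀), z.2.2 ∈ X → ∀ t ∈ Ioo 0 z.1, ∀ q,
      IsPerturbation X Q h t z.1 q →
        distFun Q z.2.1 z.2.2 ≤ distFun q (z.2.1 + t * (c + ε)) z.2.2 ∧
        distFun q (z.2.1 + t * (c - ε)) z.2.2 ≤ distFun Q z.2.1 z.2.2) :
    ∀ᶠ z : ℝ × ℝ × E in 𝓝 (0, p₀), z.2.2 ∈ X → ∀ t ∈ Ioo 0 z.1, ∀ q,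
      IsPerturbation X Q h t z.1 q → ∀ u ∈ Icc (0 : ℝ) 1, rearrangement Q u z.2.2 = z.2.1 →
        |rearrangement q u z.2.2 - rearrangement Q u z.2.2 - t * c| ≤ t * ε := by
  obtain ⟨H, hH0, hH⟩ := exists_abs_le hX hh
  obtain ⟨B, hB0, hB⟩ := exists_abs_le hX hQ
  filter_upwards [eventually_eventually_nhds.2 hbr] with z hz hzX t ht q hq u hu hy
  have htend : Tendsto (fun y => (z.1, y, z.2.2)) (𝓝 z.2.1) (𝓝 z) :=
    Continuous.tendsto (by fun_prop) z.2.1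
  have hy' := htend.eventually hz
  rw [← hy] at hy'
  have hqm := measurable_section hq.1 hzX
  have hQm := continuousOn_measurable_section (continuousOn_section hQ hzX)
  have hqb : ∀ u ∈ Icc (0 : ℝ) 1, |q u z.2.2| ≤ B + t * H + z.1 * t := by
    intro u hu
    have h1 := abs_le.1 (hq.2 u hu _ hzX)
    have h2 := abs_le.1 (hH u hu _ hzX)
    have h3 := abs_le.1 (hB u hu _ hzX)
    have h4 : t * h u z.2.2 ≤ t * H := mul_le_mul_of_nonneg_left h2.2 ht.1.le
    have h5 : t * -H ≤ t * h u z.2.2 := mul_le_mul_of_nonneg_left h2.1 ht.1.le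
    exact abs_le.2 ⟨by linarith, by linarith⟩
  have hQb : ∀ u ∈ Icc (0 : ℝ) 1, |Q u z.2.2| ≤ B := fun u hu => hB u hu _ hzX
  have h1 := rearrangement_le_add hQm hqm hQb hqb (k := t * (c + ε)) hu.2
    (nhdsWithin_le_nhds (hy'.mono fun y hy => (hy hzX t ht q hq).1))
  have h2 := add_le_rearrangement hQm hqm hQb hqb (k := t * (c - ε)) hu.2
    (nhdsWithin_le_nhds (hy'.mono fun y hy => (hy hzX t ht q hq).2))
  exact abs_le.2 ⟨by linarith, by linarith⟩

/-! ### Uniform derivatives and the delta method -/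

/-- `D` is the derivative at `Q` in the direction `h` of the increment `Φ` (a map with
`Φ Q = 0`), uniformly in the index `τ` and in all perturbations `q` with `|q - Q - t h| ≤ δ t`. -/
def HasUniformDerivative {E T : Type*} [MeasurableSpace E] (X : Set E) (Q h : ℝ → E → ℝ)
    (Φ : (ℝ → E → ℝ) → T → ℝ) (D : T → ℝ) : Prop :=
  ∀ ε > 0, ∃ δ > 0, ∀ t ∈ Ioo 0 δ, ∀ q, IsPerturbation X Q h t δ q →
    ∀ τ, |Φ q τ - t * D τ| ≤ t * ε

theorem IsPerturbation.mono {E : Type*} [MeasurableSpace E] {X : Set E} {Q h q : ℝ → E → ℝ}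
    {t δ δ' : ℝ} (hq : IsPerturbation X Q h t δ q) (ht : 0 ≤ t) (hδ : δ ≤ δ') :
    IsPerturbation X Q h t δ' q :=
  ⟨hq.1, fun u hu x hx => (hq.2 u hu x hx).trans (mul_le_mul_of_nonneg_right hδ ht)⟩

theorem isPerturbation_add_mul {E : Type*} [MeasurableSpace E] {X : Set E} {Q h : ℝ → E → ℝ}
    (hQ : Measurable fun p : domUX X => Q p.1.1 p.1.2)
    (hh : Measurable fun p : domUX X => h p.1.1 p.1.2) {t δ : ℝ} (ht : 0 ≤ t) (hδ : 0 ≤ δ) :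
    IsPerturbation X Q h t δ (fun u x => Q u x + t * h u x) := by
  refine ⟨hQ.add (hh.const_mul t), fun u _ x _ => ?_⟩
  have e : Q u x + t * h u x - Q u x - t * h u x = 0 := by ring
  rw [e, abs_zero]
  positivity

/-- Local expansions around the points of a compact set `K` yield a uniform one. The index `τ` has the
base point `π τ ∈ K`, and `D p` is the derivative at the centre `p` of the neighbourhood. -/
theorem hasUniformDerivative_of_eventually {E T : Type*} [TopologicalSpace E] [MeasurableSpace E]
    {X : Set E} {Q h : ℝ → E → ℝ} (hQ : Measurable fun p : domUX X => Q p.1.1 p.1.2)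
    (hh : Measurable fun p : domUX X => h p.1.1 p.1.2) {K : Set (ℝ × E)} (hK : IsCompact K)
    {π : T → ℝ × E} (hπ : ∀ τ, π τ ∈ K) {Φ : (ℝ → E → ℝ) → T → ℝ} {D : ℝ × E → ℝ}
    (hloc : ∀ p ∈ K, ∀ ε > 0, ∀ᶠ z : ℝ × ℝ × E in 𝓝 (0, p), ∀ τ, π τ = z.2 → ∀ t ∈ Ioo 0 z.1,
      ∀ q, IsPerturbation X Q h t z.1 q → |Φ q τ - t * D p| ≤ t * ε) :
    HasUniformDerivative X Q h Φ fun τ => D (π τ) := by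
  intro ε hε
  have hunif := hK.eventually_forall_of_forall_eventually (x₀ := (0 : ℝ))
    (P := fun δ p => ∀ τ, π τ = p → ∀ t ∈ Ioo 0 δ, ∀ q, IsPerturbation X Q h t δ q →
      |Φ q τ - t * D p| ≤ t * ε) ?_
  · obtain ⟨δ, hδ, hδ0⟩ := ((eventually_nhdsWithin_of_eventually_nhds hunif).and
      (self_mem_nhdsWithin (s := Ioi (0 : ℝ)))).exists
    exact ⟨δ, hδ0, fun t ht q hq τ => hδ (π τ) (hπ τ) τ rfl t ht q hq⟩
  · intro p hp
    filter_upwards [hloc p hp (ε / 3) (by linarith)] with z hz τ hτ t ht q hq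
    have hz0 : 0 < z.1 := ht.1.trans ht.2
    -- Comparing the two local expansions of `Φ (Q + s h) τ` bounds `D z.2 - D p`.
    have hD : |D z.2 - D p| ≤ 2 * (ε / 3) := by
      have h1 := hloc z.2 (hτ ▸ hπ τ) (ε / 3) (by linarith)
      have htend : Tendsto (fun s : ℝ => (s, z.2)) (𝓝[>] 0) (𝓝 (0, z.2)) :=
        (Continuous.tendsto (by fun_prop) (0 : ℝ)).mono_left nhdsWithin_le_nhds
      obtain ⟨s, ⟨hs, hsz⟩, hs0⟩ := (((htend.eventually h1).and
        (eventually_nhdsWithin_of_eventually_nhds (gt_mem_nhds hz0))).and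
          self_mem_nhdsWithin).exists
      have hs0 : 0 < s := hs0
      have hpos : 0 < s / 2 := by linarith
      have h2 := abs_le.1 (hs τ hτ (s / 2) ⟨hpos, by dsimp only; linarith⟩ _
        (isPerturbation_add_mul hQ hh hpos.le hs0.le))
      have h3 := abs_le.1 (hz τ hτ (s / 2) ⟨hpos, by linarith⟩ _
        (isPerturbation_add_mul hQ hh hpos.le hz0.le))
      refine le_of_mul_le_mul_left ?_ hpos
      rw [← abs_of_pos hpos, ← abs_mul, abs_of_pos hpos, mul_sub]
      exact abs_le.2 ⟨by linarith, by linarith⟩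
    have h4 := abs_le.1 (hz τ hτ t ht q hq)
    have hD' : |t * (D z.2 - D p)| ≤ t * (2 * (ε / 3)) := by
      rw [abs_mul, abs_of_pos ht.1]
      exact mul_le_mul_of_nonneg_left hD ht.1.le
    have h5 := abs_le.1 hD'
    rw [mul_sub] at h5
    exact abs_le.2 ⟨by linarith, by linarith⟩

/-- Functional delta method for maps of a random curve with a uniform derivative at `Q`. -/
theorem ConvergesWeakly.of_hasUniformDerivative {E T : Type*} [MeasurableSpace E]
    [MeasurableSpace T] {X : Set E} {Q : ℝ → E → ℝ} {Ω : ℕ → Type*}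
    [∀ n, MeasurableSpace (Ω n)] {P : ∀ n, Measure (Ω n)} [∀ n, IsProbabilityMeasure (P n)]
    {Ω' : Type*} [MeasurableSpace Ω'] {P' : Measure Ω'} [IsProbabilityMeasure P']
    {Qhat : ∀ n, Ω n → ℝ → E → ℝ} {a : ℕ → ℝ} {G : Ω' → ℝ → E → ℝ}
    (hFCLT : ConvergesWeakly P (fun n ω (p : domUX X) =>
      a n * (Qhat n ω p.1.1 p.1.2 - Q p.1.1 p.1.2)) P' (fun ω (p : domUX X) => G ω p.1.1 p.1.2))
    (ha : Tendsto a atTop atTop)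
    (hQm : Measurable fun p : domUX X => Q p.1.1 p.1.2)
    (hQb : ∃ C, ∀ u ∈ Icc (0 : ℝ) 1, ∀ x ∈ X, |Q u x| ≤ C)
    (hQhm : ∀ n ω, Measurable fun p : domUX X => Qhat n ω p.1.1 p.1.2)
    (hQhb : ∀ n ω, ∃ C, ∀ u ∈ Icc (0 : ℝ) 1, ∀ x ∈ X, |Qhat n ω u x| ≤ C)
    (hGm : ∀ ω, Measurable fun p : domUX X => G ω p.1.1 p.1.2)
    (hGb : ∀ ω, ∃ C, ∀ u ∈ Icc (0 : ℝ) 1, ∀ x ∈ X, |G ω u x| ≤ C)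
    {Φ : (ℝ → E → ℝ) → T → ℝ} {D : (ℝ → E → ℝ) → T → ℝ}
    (hΦ : ∀ q : ℝ → E → ℝ, (Measurable fun p : domUX X => q p.1.1 p.1.2) →
      (∃ C, ∀ u ∈ Icc (0 : ℝ) 1, ∀ x ∈ X, |q u x| ≤ C) →
      Measurable (Φ q) ∧ ∃ C, ∀ τ, |Φ q τ| ≤ C)
    (hD : ∀ ω, HasUniformDerivative X Q (G ω) Φ (D (G ω))) :
    ConvergesWeakly P (fun n ω τ => a n * Φ (Qhat n ω) τ) P' (fun ω τ => D (G ω) τ) := by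
  have hΦG : ∀ ω (t : ℝ), Measurable (Φ fun u x => Q u x + t * G ω u x) ∧
      ∃ C, ∀ τ, |Φ (fun u x => Q u x + t * G ω u x) τ| ≤ C := by
    intro ω t
    obtain ⟨B, hB⟩ := hQb
    obtain ⟨H, hH⟩ := hGb ω
    refine hΦ _ (hQm.add ((hGm ω).const_mul t)) ⟨B + |t| * H, fun u hu x hx => ?_⟩
    refine (abs_add_le _ _).trans (add_le_add (hB u hu x hx) ?_)
    rw [abs_mul]
    exact mul_le_mul_of_nonneg_left (hH u hu x hx) (abs_nonneg t)
  refine hFCLT.of_continuous_convergence (fun n ω => ?_) (fun n ω => ?_) (fun ω => ?_)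
    (fun ω => ?_) (fun ω ε hε => ?_) (fun ω ε hε => ?_)
  · exact ((hΦ _ (hQhm n ω) (hQhb n ω)).1).const_mul (a n)
  · obtain ⟨C, hC⟩ := (hΦ _ (hQhm n ω) (hQhb n ω)).2
    refine ⟨|a n| * C, fun τ => ?_⟩
    rw [abs_mul]
    exact mul_le_mul_of_nonneg_left (hC τ) (abs_nonneg _)
  · -- `D (G ω)` is a pointwise limit of difference quotients along `Q + t G ω`.
    refine measurable_of_tendsto_metrizable' (𝓝[>] (0 : ℝ))
      (f := fun t τ => t⁻¹ * Φ (fun u x => Q u x + t * G ω u x) τ)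
      (fun t => ((hΦG ω t).1).const_mul _) ?_
    rw [tendsto_pi_nhds]
    intro τ
    refine Metric.tendsto_nhds.2 fun ε hε => ?_
    obtain ⟨δ, hδ, h⟩ := hD ω (ε / 2) (by linarith)
    filter_upwards [Ioo_mem_nhdsGT hδ] with t ht
    have h1 := h t ht _ (isPerturbation_add_mul hQm (hGm ω) ht.1.le hδ.le) τ
    have e : t⁻¹ * Φ (fun u x => Q u x + t * G ω u x) τ - D (G ω) τ
        = t⁻¹ * (Φ (fun u x => Q u x + t * G ω u x) τ - t * D (G ω) τ) := by
      have := ht.1.ne'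
      field_simp
    rw [Real.dist_eq, e, abs_mul, abs_of_pos (inv_pos.2 ht.1)]
    calc t⁻¹ * _ ≤ t⁻¹ * (t * (ε / 2)) := mul_le_mul_of_nonneg_left h1 (inv_pos.2 ht.1).le
      _ = ε / 2 := by rw [inv_mul_cancel_left₀ ht.1.ne']
      _ < ε := by linarith
  · obtain ⟨δ, hδ, h⟩ := hD ω 1 one_pos
    have ht : δ / 2 ∈ Ioo 0 δ := ⟨by linarith, by linarith⟩
    obtain ⟨C, hC⟩ := (hΦG ω (δ / 2)).2
    refine ⟨(C + δ / 2) / (δ / 2), fun τ => ?_⟩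
    have h1 := abs_le.1 (h _ ht _ (isPerturbation_add_mul hQm (hGm ω) ht.1.le hδ.le) τ)
    have h2 := abs_le.1 (hC τ)
    rw [le_div_iff₀ ht.1, mul_comm, ← abs_of_pos ht.1, ← abs_mul, abs_of_pos ht.1]
    exact abs_le.2 ⟨by linarith, by linarith⟩
  · -- `Q + t G ω'` is a perturbation both in the direction `G ω` and in the direction `G ω'`.
    obtain ⟨δ, hδ, h⟩ := hD ω (ε / 2) (by linarith)
    refine ⟨δ, hδ, fun ω' hω' τ => ?_⟩
    obtain ⟨δ', hδ', h'⟩ := hD ω' (ε / 2) (by linarith)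
    obtain ⟨t, ht0, ht⟩ := exists_between (lt_min hδ hδ')
    have htδ := lt_min_iff.1 ht
    have hp := isPerturbation_add_mul hQm (hGm ω') ht0.le hδ'.le
    have hp' : IsPerturbation X Q (G ω) t δ fun u x => Q u x + t * G ω' u x := by
      refine ⟨hp.1, fun u hu x hx => ?_⟩
      have e : Q u x + t * G ω' u x - Q u x - t * G ω u x = t * (G ω' u x - G ω u x) := by ring
      rw [e, abs_mul, abs_of_pos ht0, mul_comm]
      exact mul_le_mul_of_nonneg_right (hω' ⟨(u, x), hu, hx⟩) ht0.le
    have h1 := abs_le.1 (h t ⟨ht0, htδ.1⟩ _ hp' τ)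
    have h2 := abs_le.1 (h' t ⟨ht0, htδ.2⟩ _ hp τ)
    refine le_of_mul_le_mul_left ?_ ht0
    rw [← abs_of_pos ht0, ← abs_mul, abs_of_pos ht0, mul_sub]
    exact abs_le.2 ⟨by linarith, by linarith⟩
  · obtain ⟨δ, hδ, h⟩ := hD ω ε hε
    -- The size of the perturbation is `t = 1 / a n`.
    obtain ⟨N, hN⟩ := eventually_atTop.1 (ha.eventually_gt_atTop δ⁻¹)
    refine ⟨δ, hδ, N, fun n hn ω' hω' τ => ?_⟩
    have han := hN n hn
    have ha0 : 0 < a n := (inv_pos.2 hδ).trans han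
    have ht : (a n)⁻¹ ∈ Ioo 0 δ := ⟨inv_pos.2 ha0, inv_lt_of_inv_lt₀ hδ han⟩
    have hp : IsPerturbation X Q (G ω) (a n)⁻¹ δ (Qhat n ω') := by
      refine ⟨hQhm n ω', fun u hu x hx => ?_⟩
      have e : Qhat n ω' u x - Q u x - (a n)⁻¹ * G ω u x
          = (a n)⁻¹ * (a n * (Qhat n ω' u x - Q u x) - G ω u x) := by field_simp
      rw [e, abs_mul, abs_of_pos ht.1, mul_comm]
      exact mul_le_mul_of_nonneg_right (hω' ⟨(u, x), hu, hx⟩) ht.1.le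
    have h1 := h _ ht _ hp τ
    have e : a n * Φ (Qhat n ω') τ - D (G ω) τ
        = a n * (Φ (Qhat n ω') τ - (a n)⁻¹ * D (G ω) τ) := by field_simp
    rw [e, abs_mul, abs_of_pos ha0]
    calc a n * _ ≤ a n * ((a n)⁻¹ * ε) := mul_le_mul_of_nonneg_left h1 ha0.le
      _ = ε := mul_inv_cancel_left₀ ha0.ne' _

/-! ### Measurability and the limit laws -/

theorem measurable_distFun {E Y : Type*} [MeasurableSpace E] [MeasurableSpace Y]
    {X : Set E} (hX : MeasurableSet X) {q : ℝ → E → ℝ}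
    (hq : Measurable fun p : domUX X => q p.1.1 p.1.2) {f : Y → ℝ} {g : Y → E}
    (hf : Measurable f) (hg : Measurable g) (hgX : ∀ τ, g τ ∈ X) :
    Measurable fun τ => distFun q (f τ) (g τ) := by
  have hdom : MeasurableSet (domUX X) := measurableSet_Icc.prod hX
  obtain ⟨q', hq'm, hq'⟩ := (MeasurableEmbedding.subtype_coe hdom).exists_measurable_extend hq
    fun _ => ⟨0⟩
  have hq'eq : ∀ u ∈ Icc (0 : ℝ) 1, ∀ x ∈ X, q' (u, x) = q u x := fun u hu x hx =>
    congrFun hq' ⟨(u, x), hu, hx⟩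
  -- The curve is only given on `[0,1] × X`, so a measurable extension is integrated instead.
  have heq : ∀ τ, distFun q (f τ) (g τ)
      = ∫ v in Icc (0 : ℝ) 1, {w : Y × ℝ | q' (w.2, g w.1) ≤ f w.1}.indicator 1 (τ, v) := by
    intro τ
    rw [distFun, intervalIntegral.integral_of_le zero_le_one, ← integral_Icc_eq_integral_Ioc]
    refine setIntegral_congr_fun measurableSet_Icc fun v hv => ?_
    simp only [indicator, mem_ofPred_eq, hq'eq v hv _ (hgX τ), Pi.one_apply]
  simp only [heq]
  have hset : MeasurableSet {w : Y × ℝ | q' (w.2, g w.1) ≤ f w.1} :=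
    measurableSet_le (hq'm.comp (measurable_snd.prodMk (hg.comp measurable_fst)))
      (hf.comp measurable_fst)
  have hmeas : Measurable ({w : Y × ℝ | q' (w.2, g w.1) ≤ f w.1}.indicator (1 : Y × ℝ → ℝ)) :=
    measurable_one.indicator hset
  exact (hmeas.stronglyMeasurable.integral_prod_right'
    (ν := volume.restrict (Icc (0 : ℝ) 1))).measurable

theorem measurable_rearrangement {E Y : Type*} [MeasurableSpace E] [MeasurableSpace Y]
    {X : Set E} (hX : MeasurableSet X) {q : ℝ → E → ℝ}
    (hq : Measurable fun p : domUX X => q p.1.1 p.1.2) {C : ℝ}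
    (hC : ∀ u ∈ Icc (0 : ℝ) 1, ∀ x ∈ X, |q u x| ≤ C) {f : Y → ℝ} {g : Y → E}
    (hf : Measurable f) (hg : Measurable g) (hf1 : ∀ τ, f τ ≤ 1) (hgX : ∀ τ, g τ ∈ X) :
    Measurable fun τ => rearrangement q (f τ) (g τ) := by
  refine measurable_of_Iio fun y => ?_
  have : (fun τ => rearrangement q (f τ) (g τ)) ⁻¹' Iio y = ⋃ r : ℚ,
      {τ | (r : ℝ) < y ∧ f τ ≤ distFun q r (g τ) ∧ 0 < distFun q r (g τ)} := by
    ext τ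
    simp only [mem_preimage, mem_Iio, mem_iUnion, mem_ofPred_eq]
    exact rearrangement_lt_iff (measurable_section hq (hgX τ)) (fun u hu => hC u hu _ (hgX τ))
      (hf1 τ) y
  rw [this]
  refine MeasurableSet.iUnion fun r => ?_
  have hm := measurable_distFun hX hq (measurable_const (a := (r : ℝ))) hg hgX
  exact (MeasurableSet.const _).inter
    ((measurableSet_le hf hm).inter (measurableSet_lt measurable_const hm))

theorem abs_distFun_sub_le_one {E : Type*} {q q' : ℝ → E → ℝ} {x : E}
    (hq : Measurable fun v : Icc (0 : ℝ) 1 => q v x)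
    (hq' : Measurable fun v : Icc (0 : ℝ) 1 => q' v x) (y : ℝ) :
    |distFun q y x - distFun q' y x| ≤ 1 := by
  have h : ∀ A : Set ℝ, volume.real (Icc (0 : ℝ) 1 ∩ A) ≤ 1 := fun A => by
    have := measureReal_mono (μ := volume) (inter_subset_left (s := Icc (0 : ℝ) 1) (t := A))
      (by simp)
    simpa using this
  rw [distFun_eq_measureReal hq, distFun_eq_measureReal hq']
  have h0 : ∀ A : Set ℝ, 0 ≤ volume.real (Icc (0 : ℝ) 1 ∩ A) := fun A => measureReal_nonneg
  exact abs_le.2 ⟨by linarith [h {v | q' v x ≤ y}, h0 {v | q v x ≤ y}],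
    by linarith [h {v | q v x ≤ y}, h0 {v | q' v x ≤ y}]⟩

theorem proposition5 {d : ℕ} (X : Set (EuclideanSpace ℝ (Fin d))) (hX : IsCompact X)
    (Q : ℝ → EuclideanSpace ℝ (Fin d) → ℝ) (hQ : IsAdmissibleCurve X Q)
    {Ω : ℕ → Type*} [∀ n, MeasurableSpace (Ω n)] (P : ∀ n, Measure (Ω n))
    [∀ n, IsProbabilityMeasure (P n)]
    {Ω' : Type*} [MeasurableSpace Ω'] (P' : Measure Ω') [IsProbabilityMeasure P']
    -- the estimators: every realization is a bounded measurable function on `[0,1] × X`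
    (Qhat : ∀ n, Ω n → ℝ → EuclideanSpace ℝ (Fin d) → ℝ)
    (hQhat_meas : ∀ n ω, Measurable (fun p : domUX X => Qhat n ω p.1.1 p.1.2))
    (hQhat_bdd : ∀ n ω, ∃ C : ℝ, ∀ p ∈ domUX X, |Qhat n ω p.1 p.2| ≤ C)
    (a : ℕ → ℝ) (ha : Tendsto a atTop atTop)
    -- the limit process, with continuous paths
    (G : Ω' → ℝ → EuclideanSpace ℝ (Fin d) → ℝ)
    (hG : ∀ ω, ContinuousOn (fun p : ℝ × EuclideanSpace ℝ (Fin d) => G ω p.1 p.2) (domUX X))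
    (hFCLT : ConvergesWeakly P
      (fun n ω (p : domUX X) => a n * (Qhat n ω p.1.1 p.1.2 - Q p.1.1 p.1.2))
      P' (fun ω (p : domUX X) => G ω p.1.1 p.1.2)) :
    -- limit law of the distribution functions, away from the values at the endpoints of `[0,1]`
    (∀ K : Set (ℝ × EuclideanSpace ℝ (Fin d)), IsCompact K → K ⊆ regYX Q X →
      (∀ p ∈ K, Q 0 p.2 ≠ p.1 ∧ Q 1 p.2 ≠ p.1) →
      ConvergesWeakly P
        (fun n ω (p : K) => a n * (distFun (Qhat n ω) p.1.1 p.1.2 - distFun Q p.1.1 p.1.2))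
        P' (fun ω (p : K) => derivF Q (G ω) p.1.1 p.1.2)) ∧
    -- limit law of the rearranged curves; a value at an endpoint is allowed if attained only there
    (∀ K : Set (ℝ × EuclideanSpace ℝ (Fin d)), IsCompact K → K ⊆ regYX Q X →
      (∀ p ∈ K, (Q 0 p.2 ≠ p.1 ∧ Q 1 p.2 ≠ p.1) ∨ ∃! u, u ∈ rootSet Q p.1 p.2) →
      ConvergesWeakly P
        (fun n ω (p : domUXK Q X K) =>
          a n * (rearrangement (Qhat n ω) p.1.1 p.1.2 - rearrangement Q p.1.1 p.1.2))
        P' (fun ω (p : domUXK Q X K) => derivQ Q (G ω) p.1.1 p.1.2)) := by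
  have hcm : ∀ h : ℝ → EuclideanSpace ℝ (Fin d) → ℝ,
      ContinuousOn (fun p : ℝ × EuclideanSpace ℝ (Fin d) => h p.1 p.2) (domUX X) →
      Measurable fun p : domUX X => h p.1.1 p.1.2 := fun h hh =>
    (continuousOn_iff_continuous_domRestrict.1 hh).measurable
  have hcb : ∀ h : ℝ → EuclideanSpace ℝ (Fin d) → ℝ,
      ContinuousOn (fun p : ℝ × EuclideanSpace ℝ (Fin d) => h p.1 p.2) (domUX X) →
      ∃ C, ∀ u ∈ Icc (0 : ℝ) 1, ∀ x ∈ X, |h u x| ≤ C := fun h hh =>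
    (exists_abs_le hX hh).imp fun _ hC => hC.2
  have hQm := hcm Q hQ.continuousOn
  have hQb := hcb Q hQ.continuousOn
  have hQhb : ∀ n ω, ∃ C, ∀ u ∈ Icc (0 : ℝ) 1, ∀ x ∈ X, |Qhat n ω u x| ≤ C := fun n ω =>
    (hQhat_bdd n ω).imp fun C hC u hu x hx => hC (u, x) ⟨hu, hx⟩
  have hGm := fun ω => hcm _ (hG ω)
  have hGb := fun ω => hcb _ (hG ω)
  have hXm : MeasurableSet X := hX.isClosed.measurableSet
  refine ⟨fun K hK hKreg hends => ?_, fun K hK hKreg hends => ?_⟩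
  · refine hFCLT.of_hasUniformDerivative ha hQm hQb hQhat_meas hQhb hGm hGb
      (Φ := fun q (p : K) => distFun q p.1.1 p.1.2 - distFun Q p.1.1 p.1.2)
      (D := fun h (p : K) => derivF Q h p.1.1 p.1.2) (fun q hqm hqb => ⟨?_, 1, fun p => ?_⟩)
      fun ω => ?_
    · have hy : Measurable fun p : K => p.1.1 := measurable_fst.comp measurable_subtype_coe
      have hx : Measurable fun p : K => p.1.2 := measurable_snd.comp measurable_subtype_coe
      exact (measurable_distFun hXm hqm hy hx fun p => (hKreg p.2).1).sub
        (measurable_distFun hXm hQm hy hx fun p => (hKreg p.2).1)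
    · have hpX := (hKreg p.2).1
      exact abs_distFun_sub_le_one (measurable_section hqm hpX) (measurable_section hQm hpX) _
    · refine hasUniformDerivative_of_eventually (π := fun p : K => p.1)
        (D := fun p => derivF Q (G ω) p.1 p.2) hQm (hGm ω) hK (fun p => p.2) fun p hp ε hε => ?_
      filter_upwards [eventually_abs_distFun_sub hX hQ (hG ω) (hKreg hp).1 (hKreg hp).2
        (hends p hp) hε] with z hz τ hτ t ht q hq
      rw [hτ]
      exact hz (hτ ▸ (hKreg τ.2).1) t ht q hq
  · refine hFCLT.of_hasUniformDerivative ha hQm hQb hQhat_meas hQhb hGm hGb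
      (Φ := fun q (p : domUXK Q X K) => rearrangement q p.1.1 p.1.2 - rearrangement Q p.1.1 p.1.2)
      (D := fun h (p : domUXK Q X K) => derivQ Q h p.1.1 p.1.2) (fun q hqm hqb => ?_) fun ω => ?_
    · obtain ⟨B, hB⟩ := hQb
      obtain ⟨C, hC⟩ := hqb
      have hu : Measurable fun p : domUXK Q X K => p.1.1 :=
        measurable_fst.comp measurable_subtype_coe
      have hx : Measurable fun p : domUXK Q X K => p.1.2 :=
        measurable_snd.comp measurable_subtype_coe
      refine ⟨?_, C + B, fun p => ?_⟩
      · exact (measurable_rearrangement hXm hqm hC hu hx (fun p => p.2.1.1.2) fun p => p.2.1.2).sub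
          (measurable_rearrangement hXm hQm hB hu hx (fun p => p.2.1.1.2) fun p => p.2.1.2)
      · have hpX : p.1.2 ∈ X := p.2.1.2
        exact (abs_sub _ _).trans (add_le_add
          (abs_rearrangement_le (measurable_section hqm hpX) (fun u hu => hC u hu _ hpX)
            p.2.1.1.2)
          (abs_rearrangement_le (measurable_section hQm hpX) (fun u hu => hB u hu _ hpX)
            p.2.1.1.2))
    · refine hasUniformDerivative_of_eventually
        (π := fun p : domUXK Q X K => (rearrangement Q p.1.1 p.1.2, p.1.2))
        (D := fun p => -(1 / densF Q p.1 p.2) * derivF Q (G ω) p.1 p.2) hQm (hGm ω) hK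
        (fun p => p.2.2) fun p hp ε hε => ?_
      have hbr : ∀ᶠ z : ℝ × ℝ × EuclideanSpace ℝ (Fin d) in 𝓝 (0, p), z.2.2 ∈ X →
          ∀ t ∈ Ioo 0 z.1, ∀ q, IsPerturbation X Q (G ω) t z.1 q →
          distFun Q z.2.1 z.2.2 ≤ distFun q (z.2.1 + t *
            (-(1 / densF Q p.1 p.2) * derivF Q (G ω) p.1 p.2 + ε)) z.2.2 ∧
          distFun q (z.2.1 + t * (-(1 / densF Q p.1 p.2) * derivF Q (G ω) p.1 p.2 - ε)) z.2.2
            ≤ distFun Q z.2.1 z.2.2 := by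
        obtain ⟨hpX, hreg⟩ := hKreg hp
        rcases hends p hp with he | ⟨r, hr, huniq⟩
        · exact eventually_distFun_bracket_of_ends hX hQ (hG ω) hpX hreg he hε
        · have hr' : rootSet Q p.1 p.2 = {r} := eq_singleton_iff_unique_mem.2 ⟨hr, huniq⟩
          rw [neg_inv_densF_mul_derivF_of_unique hr' hreg]
          exact eventually_distFun_bracket_of_unique hX hQ.continuousOn (hG ω) hpX hr' hε
      filter_upwards [eventually_abs_rearrangement_sub hX hQ.continuousOn (hG ω) hbr]
        with z hz τ hτ t ht q hq
      obtain ⟨h1, h2⟩ := Prod.ext_iff.1 hτ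
      dsimp only at h1 h2
      have hτX : τ.1.2 ∈ X := τ.2.1.2
      have := hz (h2 ▸ hτX) t ht q hq τ.1.1 τ.2.1.1
      rw [← h2] at this
      exact this h1
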